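/- **Setting.** Digraphs may have self-loops. A *tournament* is a set of looped nodes, any two distinct ones joined by exactly one edge, with no cycles other than the loops. Two nodes are *connected* if at least one of the two edges between them is present, and joined by a *double edge* if both are. For $p\in\mathbb N$ put $k=\lceil\log_{1.5}4p^2\rceil$ and $n=\lfloor 2^{k-c}\rfloor$ with $c=10+\frac16$. For a node set $S$, let $U_S$ (resp. $L_S$) be the set of un-looped nodes (resp. looped nodes outside $S$) connected to every node of $S$, and $U_0(S)$ the set of un-looped nodes $u$ with no single edge into $S$ (no $s\in S$ with $(u,s)$ present and $(s,u)$ absent). Let $\mathcal N_p$ be the set of digraphs on $\{1,\dots,2n+k-1\}$ that have exactly one $k$-node tournament $T$ and satisfy $|U|=n$ for the set $U$ of un-looped nodes, $|L|=n-1$ for the set $L$ of looped nodes outside $T$, and $|U_0(T)|=|U_T|=|L_T|+1=2p^2$. "Almost every $G\in\mathcal N$" means: with probability $1-o(1)$ as $p\to\infty$ under the uniform distribution on $\mathcal N_p$. **Colorings.** Every edge (loops included) is colored blank, grey, green or red; non-edges are "absent". Let $\widetilde T$ be the set of nodes with a blank loop (the *blank nodes*). A coloring comes with a classification of its links (node pairs)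 that have a blank non-loop edge. At most one of the following directed types, in one direction, is given to a pair; in each of them the forward edge $(x,y)$ is blank, and: * $h$: exactly one of $x,y$ is looped, and $(y,x)$ is grey; * $v$: exactly one of $x,y$ is looped, and $(y,x)$ is blank or, if $x$ is looped, blank or green; * $d_1$, $d_2$: both nodes are un-looped, and $(y,x)$ is red, respectively absent; * $I$: exactly one of $x,y$ is looped, $y\notin\widetilde T$, and $(y,x)$ is green, red or absent; * $K$: $x$ is un-looped, $y\in\widetilde T$, and $(y,x)$ is blank or absent; * $M$: both nodes are looped, not both are in $\widetilde T$, and $(y,x)$ is not blank. A *$C$-link* is a double edge between an un-looped node and a node of $\widetilde T$ with exactly one blank edge; it may coincide with a link of another type. Every blank non-loop edge lies in a link of one of these eight types. The constraints are: * **A.** $\widetilde T$ forms a tournament (its size is not prescribed) whose non-loop edges are green; if $\widetilde T$ is non-empty, $\widetilde t_1$ denotes its sink. * **B.** Each non-blank node has at most one $K$-link, at most one $M$-link, and at most one incoming and at most one outgoing link of each of the types $h,v,d_1,d_2,I$. $I$-links run within $U_{\widetilde T}\cup L_{\widetilde T}\cup\widetilde T$; $h,v,d_1,d_2$-links run within $U_0(\widetilde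 T)\cup L_{\widetilde T}\cup\{\widetilde t_1\}$. * **C.** Every $K$-link is between $U_{\widetilde T}$ and $\widetilde T$. * **D.** $M$-links run between nodes of $L_{\widetilde T}\cup\widetilde T$. **Counts.** Let $\widetilde b_0$ be the number of blank edges within $\widetilde T$; let $\widetilde b_1,\widetilde b_2,\widetilde b_3,\widetilde b_4,\widetilde b_6,\widetilde b_7$ be the numbers of blank edges in links of type $h,v,d_1,d_2,I,M$ respectively; let $\widetilde b_5$ be the number of $K$-links, and $\widetilde b_8$ the number of double edges between $U$ and $\widetilde T$ at least one of whose two edges is blank (so a double blank $K$-link contributes one blank to $K$ and one to $C$). Let $\widetilde b=\sum_i\widetilde b_i$. Let $b_0=k$, $b_1=4p^2$, $b_2=8p^2$, $b_3=b_4=b_5=2p^2$, $b_6=4p^2-1$, $b_7=2p^2-1$, let $b_8$ be the number of double edges between $U$ and $T$, and $b=\sum_i b_i$. **Proposition 4.** For almost every $G\in\mathcal N$, every coloring of $G$ (with a classification as above) that observes A–D and has $\widetilde b\ge b$ satisfies $\widetilde T=T$ and $\widetilde b_i\le b_i$ for all $i$; hence $\widetilde b_i=b_i$ for all $i=0,\dots,8$.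 -/

import Mathlib

open Filter Topology

namespace GraphColoration

/-! ### Digraphs, tournaments, and the node classes attached to a node set -/

section Graph

variable {V : Type*} (G : Digraph V)

/-- A node with a self-loop. -/
def Looped (x : V) : Prop := G.Adj x x

/-- Two nodes joined by a single or a double edge. -/
def Connected (x y : V) : Prop := G.Adj x y ∨ G.Adj y x

/-- Two nodes joined by both edges. -/
def Double (x y : V) : Prop := G.Adj x y ∧ G.Adj y x

/-- The nodes of `S` form a transitive tournament: every node of `S` has a self-loop, two distinct
nodes are joined by exactly one edge, and there are no cycles besides the self-loops. -/
def IsTournament (S : Set V) : Prop :=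
  (∀ x ∈ S, G.Adj x x) ∧
  (∀ x ∈ S, ∀ y ∈ S, x ≠ y → (G.Adj x y ↔ ¬ G.Adj y x)) ∧
  (∀ x ∈ S, ∀ y ∈ S, ∀ z ∈ S, G.Adj x y → G.Adj y z → G.Adj x z)

/-- The sink of `S`. -/
def IsSink (S : Set V) (t : V) : Prop :=
  t ∈ S ∧ ∀ s ∈ S, s ≠ t → ¬ G.Adj t s

/-- The set `U` of un-looped nodes. -/
def unlooped : Set V := {x | ¬ Looped G x}

/-- The looped nodes outside `S`; this is `L` when `S = T`. -/
def loopedOff (S : Set V) : Set V := {x | Looped G x ∧ x ∉ S}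

/-- `U_S`: the un-looped nodes connected to every node of `S`. -/
def unloopedConn (S : Set V) : Set V := {x | ¬ Looped G x ∧ ∀ s ∈ S, Connected G x s}

/-- `L_S`: the looped nodes outside `S` connected to every node of `S`. -/
def loopedConn (S : Set V) : Set V := {x | Looped G x ∧ x ∉ S ∧ ∀ s ∈ S, Connected G x s}

/-- `U_0` with respect to `S`: the un-looped nodes with no single edge into `S`. -/
def unloopedZero (S : Set V) : Set V :=
  {x | ¬ Looped G x ∧ ∀ s ∈ S, ¬ (G.Adj x s ∧ ¬ G.Adj s x)}

end Graph

/-! ### The parameters and the class `𝒩` -/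

/-- `k = ⌈log_{1.5} 4p²⌉`. -/
noncomputable def kOf (p : ℕ) : ℕ := ⌈Real.logb (3 / 2) (4 * (p : ℝ) ^ 2)⌉₊

/-- `n = ⌊2^{k-c}⌋` with `c = 10 + 1/6`. -/
noncomputable def nOf (p : ℕ) : ℕ := ⌊(2 : ℝ) ^ ((kOf p : ℝ) - (10 + 1 / 6))⌋₊

/-- The number `2n + k - 1` of nodes. -/
noncomputable def numNodes (p : ℕ) : ℕ := 2 * nOf p + kOf p - 1

/-- `𝒩_p`: the labelled digraphs on `2n + k - 1` nodes that have exactly one `k`-node tournament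
`T`, and whose sets `U, L, U_T, L_T, U_0` have the prescribed sizes. -/
def classN (p : ℕ) : Set (Digraph (Fin (numNodes p))) :=
  {G | ∃ T : Set (Fin (numNodes p)),
    {S | IsTournament G S ∧ S.ncard = kOf p} = {T} ∧
    (unlooped G).ncard = nOf p ∧
    (loopedOff G T).ncard + 1 = nOf p ∧
    (unloopedZero G T).ncard = 2 * p ^ 2 ∧
    (unloopedConn G T).ncard = 2 * p ^ 2 ∧
    (loopedConn G T).ncard + 1 = 2 * p ^ 2}

/-! ### Colorings and links -/

/-- The four colors of edges, and `absent` for the non-edges. -/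
inductive Color
  | absent
  | blank
  | grey
  | green
  | red

/-- The directed types of links with a blank non-loop edge, other than `C`. -/
inductive LinkType
  | h
  | v
  | d₁
  | d₂
  | K
  | I
  | M

/-- An edge coloring of `G` (self-loops included). -/
structure EdgeColoring {V : Type*} (G : Digraph V) where
  color : V → V → Color
  absent_iff : ∀ x y, color x y = Color.absent ↔ ¬ G.Adj x y

namespace EdgeColoring

variable {V : Type*} {G : Digraph V} (χ : EdgeColoring G)

/-- The edge from `x` to `y` is present and blank. -/
def Blank (x y : V) : Prop := χ.color x y = Color.blank

/-- `T̃`: the set of nodes whose self-loop is blank. -/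
def blankNodes : Set V := {x | χ.Blank x x}

/-- Exactly one of the two nodes has a self-loop. -/
def Alternating (_ : EdgeColoring G) (x y : V) : Prop := Looped G x ↔ ¬ Looped G y

/-- How a link of a given type from `x` to `y` looks. -/
def Pattern : LinkType → V → V → Prop
  | .h, x, y => χ.Alternating x y ∧ χ.Blank x y ∧ χ.color y x = Color.grey
  | .v, x, y => χ.Alternating x y ∧ χ.Blank x y ∧
      (χ.Blank y x ∨ (Looped G x ∧ χ.color y x = Color.green))
  | .d₁, x, y => ¬ Looped G x ∧ ¬ Looped G y ∧ χ.Blank x y ∧ χ.color y x = Color.red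
  | .d₂, x, y => ¬ Looped G x ∧ ¬ Looped G y ∧ χ.Blank x y ∧ χ.color y x = Color.absent
  | .K, x, y => ¬ Looped G x ∧ y ∈ χ.blankNodes ∧ χ.Blank x y ∧
      (χ.Blank y x ∨ χ.color y x = Color.absent)
  | .I, x, y => χ.Alternating x y ∧ y ∉ χ.blankNodes ∧ χ.Blank x y ∧
      (χ.color y x = Color.green ∨ χ.color y x = Color.red ∨ χ.color y x = Color.absent)
  | .M, x, y => Looped G x ∧ Looped G y ∧ ¬ (x ∈ χ.blankNodes ∧ y ∈ χ.blankNodes) ∧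
      χ.Blank x y ∧ ¬ χ.Blank y x

/-- A `C`-link: `u` is un-looped, `t ∈ T̃`, both edges are present, exactly one is blank. -/
def IsCLink (u t : V) : Prop :=
  ¬ Looped G u ∧ t ∈ χ.blankNodes ∧ Double G u t ∧ Xor (χ.Blank u t) (χ.Blank t u)

end EdgeColoring

/-- A coloring of `G` in which every link with a blank non-loop edge is assigned a directed type.
The types `h, v, d₁, d₂, K, I, M` exclude each other; a `C`-link, and the `C`-part of a double
blank link, lies between an un-looped node and `T̃` and is read off the colors. -/
structure TypedColoring {V : Type*} (G : Digraph V) extends EdgeColoring G where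
  /-- `link τ x y`: there is a link of type `τ` from `x` to `y`. -/
  link : LinkType → V → V → Prop
  pattern : ∀ τ x y, link τ x y → toEdgeColoring.Pattern τ x y
  type_unique : ∀ σ τ x y, link σ x y → link τ x y → σ = τ
  directed : ∀ σ τ x y, link σ x y → ¬ link τ y x
  typed : ∀ x y, x ≠ y → toEdgeColoring.Blank x y →
    (∃ τ, link τ x y ∨ link τ y x) ∨ toEdgeColoring.IsCLink x y ∨ toEdgeColoring.IsCLink y x

namespace TypedColoring

variable {V : Type*} {G : Digraph V} (χ : TypedColoring G)

/-- `T̃`, the set of nodes with a blank self-loop. -/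
abbrev blankNodes : Set V := χ.toEdgeColoring.blankNodes

/-- Constraint A: `T̃` forms a tournament whose non-loop edges are green (the loops are blank by
definition of `T̃`). The number of nodes of `T̃` is not prescribed. -/
def ConstraintA : Prop :=
  IsTournament G χ.blankNodes ∧
  ∀ x ∈ χ.blankNodes, ∀ y ∈ χ.blankNodes, x ≠ y → G.Adj x y → χ.color x y = Color.green

/-- `U_T̃ ∪ L_T̃ ∪ T̃`. -/
def inputRegion : Set V :=
  unloopedConn G χ.blankNodes ∪ loopedConn G χ.blankNodes ∪ χ.blankNodes

/-- `U_0̃ ∪ L_T̃ ∪ {t̃₁}`, where `t̃₁` is the sink of `T̃`. -/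
def gridRegion : Set V :=
  unloopedZero G χ.blankNodes ∪ loopedConn G χ.blankNodes ∪ {t | IsSink G χ.blankNodes t}

/-- Constraint B. -/
def ConstraintB : Prop :=
  -- at most one link of type `K` or `M`, in whatever direction, at a non-blank node
  (∀ τ, τ = LinkType.K ∨ τ = LinkType.M → ∀ x, x ∉ χ.blankNodes → ∀ y z,
    χ.link τ x y ∨ χ.link τ y x → χ.link τ x z ∨ χ.link τ z x → y = z) ∧
  -- at most one outgoing and one incoming link of the other types at a non-blank node
  (∀ τ, τ ≠ LinkType.K → τ ≠ LinkType.M → ∀ x, x ∉ χ.blankNodes → ∀ y z,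
    (χ.link τ x y → χ.link τ x z → y = z) ∧ (χ.link τ y x → χ.link τ z x → y = z)) ∧
  (∀ x y, χ.link .I x y → x ∈ χ.inputRegion ∧ y ∈ χ.inputRegion) ∧
  (∀ τ, τ = LinkType.h ∨ τ = LinkType.v ∨ τ = LinkType.d₁ ∨ τ = LinkType.d₂ → ∀ x y,
    χ.link τ x y → x ∈ χ.gridRegion ∧ y ∈ χ.gridRegion)

/-- Constraint C: any `K`-link is between `U_T̃` and `T̃`. -/
def ConstraintC : Prop :=
  ∀ x y, χ.link .K x y → x ∈ unloopedConn G χ.blankNodes ∧ y ∈ χ.blankNodes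

/-- Constraint D: `M`-links run between nodes in `L_T̃ ∪ T̃`. -/
def ConstraintD : Prop :=
  ∀ x y, χ.link .M x y →
    x ∈ loopedConn G χ.blankNodes ∪ χ.blankNodes ∧ y ∈ loopedConn G χ.blankNodes ∪ χ.blankNodes

/-- The number of blank edges lying in links of type `τ`. -/
noncomputable def blanksIn (τ : LinkType) : ℕ :=
  {e : V × V | χ.Blank e.1 e.2 ∧ (χ.link τ e.1 e.2 ∨ χ.link τ e.2 e.1)}.ncard

/-- `b̃_0, …, b̃_8`: the numbers of blank edges on `T̃`, and of types `h, v, d₁, d₂, K, I, M, C`.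
A `K`-link that is double blank is combined with a `C`-link: one of its two blanks counts
for `K`, the other one for `C`. -/
noncomputable def bTilde : Fin 9 → ℕ :=
  ![{e : V × V | e.1 ∈ χ.blankNodes ∧ e.2 ∈ χ.blankNodes ∧ χ.Blank e.1 e.2}.ncard,
    χ.blanksIn .h,
    χ.blanksIn .v,
    χ.blanksIn .d₁,
    χ.blanksIn .d₂,
    {e : V × V | χ.link .K e.1 e.2}.ncard,
    χ.blanksIn .I,
    χ.blanksIn .M,
    {e : V × V | ¬ Looped G e.1 ∧ e.2 ∈ χ.blankNodes ∧ Double G e.1 e.2 ∧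
      (χ.Blank e.1 e.2 ∨ χ.Blank e.2 e.1)}.ncard]

end TypedColoring

/-- `b_0, …, b_8`; the last one is the number of double edges between `U` and `T`. -/
noncomputable def bound {V : Type*} (G : Digraph V) (T : Set V) (p : ℕ) : Fin 9 → ℕ :=
  ![kOf p, 4 * p ^ 2, 8 * p ^ 2, 2 * p ^ 2, 2 * p ^ 2, 2 * p ^ 2, 4 * p ^ 2 - 1, 2 * p ^ 2 - 1,
    {e : V × V | ¬ Looped G e.1 ∧ e.2 ∈ T ∧ Double G e.1 e.2}.ncard]

/-- Every coloring of `G` that observes A–D and has `b̃ ≥ b` satisfies `T̃ = T`, `b̃_i ≤ b_i`, and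
hence `b̃_i = b_i`, for all `i`. -/
def BlanksForced {V : Type*} (G : Digraph V) (p : ℕ) : Prop :=
  ∀ T : Set V, IsTournament G T → T.ncard = kOf p →
    ∀ χ : TypedColoring G, χ.ConstraintA → χ.ConstraintB → χ.ConstraintC → χ.ConstraintD →
      ∑ i, bound G T p i ≤ ∑ i, χ.bTilde i →
        χ.blankNodes = T ∧ (∀ i, χ.bTilde i ≤ bound G T p i) ∧
          ∀ i, χ.bTilde i = bound G T p i

end GraphColoration

/-! The proof has a deterministic half and a probabilistic half.

Deterministic half. Constraints A–D allow every blank edge to be charged to a node of one of the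
classes attached to `T̃`, or to a double edge between `U` and `T̃`. This bounds each `b̃_i` by class
sizes (`TypedColoring.bTilde_le`). For `T̃ = T` these bounds are exactly the `b_i`, so `b̃ ≥ b`
forces equality everywhere. If `T̃ ≠ T`, uniqueness of `T` leaves `T̃` with fewer than `k` nodes. In
a quasirandom digraph every looped node has about `n/4` double edges to `U`, so each missing node
costs about `n/4` blanks. The other classes cannot make up for this: they are tiny if `T̃` has at
least `k/2` nodes, and otherwise they yield about `12n` blanks against a loss of about `kn/8`
(`Quasirandom.weight_lt`).

Probabilistic half. The class `𝒩` is a very thin set of digraphs, so quasirandomness must fail with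
a probability that is small even compared with that of `𝒩`. Fix `U` and `T`. Apart from the common
cost of prescribing the loops, failure has probability `exp(-Ω(n/k²))` with `n` of order `2^k`
(`pr_not_quasirandom_le`). Planting `T` and all double edges from `T` to fewer than `4p² ≤ (3/2)^k`
nodes costs only `exp(-O(k(3/2)^k))`, and `2 > 3/2` decides the comparison (`error_le`). A first
moment count shows that at least half of the planted digraphs have no second `k`-node tournament
(`Planting.le_pr_realized`). Summing over `U` and `T`, whose cells are disjoint because the digraph
determines both, bounds the exceptional proportion by `exp(-k)` (`one_sub_exp_le_ratio`). -/

set_option linter.unusedSectionVars false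

namespace GraphColoration

/-! ### Independent fair bits -/

section Bits

variable {ι : Type*}

lemma dependsOn_prod {κ : Type*} {J : Finset κ} {f : κ → (ι → Bool) → ℝ} {c : κ → Set ι}
    (hf : ∀ j ∈ J, DependsOn (f j) (c j)) :
    DependsOn (fun ω => ∏ j ∈ J, f j ω) (⋃ j ∈ J, c j) := by
  intro x y h
  refine Finset.prod_congr rfl fun j hj => hf j hj fun i hi => h i ?_
  simp only [Set.mem_iUnion]
  exact ⟨j, hj, hi⟩

lemma dependsOn_indicator {A : Set (ι → Bool)} {s : Set ι} (h : DependsOn (· ∈ A) s) :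
    DependsOn (A.indicator (1 : (ι → Bool) → ℝ)) s := by
  classical
  intro x y hxy
  have := h hxy
  simp only [eq_iff_iff] at this
  by_cases hx : x ∈ A
  · rw [Set.indicator_of_mem hx, Set.indicator_of_mem (this.1 hx)]; rfl
  · rw [Set.indicator_of_notMem hx, Set.indicator_of_notMem (mt this.2 hx)]

variable [Fintype ι] [DecidableEq ι]

/-- The mean of a function of independent fair bits. -/
noncomputable def avg (f : (ι → Bool) → ℝ) : ℝ := (∑ ω, f ω) / 2 ^ Fintype.card ι

/-- The probability of an event about independent fair bits. -/
noncomputable def pr (A : Set (ι → Bool)) : ℝ := avg (A.indicator 1)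

lemma avg_mono {f g : (ι → Bool) → ℝ} (h : ∀ ω, f ω ≤ g ω) : avg f ≤ avg g := by
  unfold avg
  gcongr
  exact h _

lemma avg_const (c : ℝ) : avg (fun _ : ι → Bool => c) = c := by
  simp [avg]

lemma avg_add (f g : (ι → Bool) → ℝ) : avg (fun ω => f ω + g ω) = avg f + avg g := by
  simp [avg, Finset.sum_add_distrib, add_div]

lemma avg_const_mul (c : ℝ) (f : (ι → Bool) → ℝ) : avg (fun ω => c * f ω) = c * avg f := by
  simp [avg, ← Finset.mul_sum, mul_div_assoc]

lemma avg_sum {κ : Type*} (J : Finset κ) (f : κ → (ι → Bool) → ℝ) :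
    avg (fun ω => ∑ j ∈ J, f j ω) = ∑ j ∈ J, avg (f j) := by
  unfold avg
  rw [Finset.sum_comm, Finset.sum_div]

/-- Take two copies of the bits and exchange them outside `s`. This involution turns `f` of the
first copy times `g` of the second into `f * g` of the first copy alone. -/
lemma avg_mul {f g : (ι → Bool) → ℝ} {s t : Set ι} (hf : DependsOn f s) (hg : DependsOn g t)
    (hst : Disjoint s t) : avg (fun ω => f ω * g ω) = avg f * avg g := by
  classical
  let σ : (ι → Bool) × (ι → Bool) → (ι → Bool) × (ι → Bool) :=
    fun q => (s.piecewise q.1 q.2, s.piecewise q.2 q.1)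
  have hσ : Function.Involutive σ := by
    rintro ⟨a, b⟩
    ext i <;> by_cases hi : i ∈ s <;> simp [σ, hi]
  have key : (∑ ω, f ω) * (∑ ω, g ω) = 2 ^ Fintype.card ι * ∑ ω, f ω * g ω := by
    calc (∑ ω, f ω) * (∑ ω, g ω) = ∑ q : (ι → Bool) × (ι → Bool), f q.1 * g q.2 := by
          rw [Finset.sum_mul_sum, ← Finset.sum_product']; rfl
      _ = ∑ q : (ι → Bool) × (ι → Bool), f (σ q).1 * g (σ q).1 := by
          refine Finset.sum_congr rfl fun q _ => ?_
          congr 1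
          · exact hf fun i hi => by simp [σ, hi]
          · exact hg fun i hi => by
              have : i ∉ s := fun h => Set.disjoint_left.1 hst h hi
              simp [σ, this]
      _ = ∑ q : (ι → Bool) × (ι → Bool), f q.1 * g q.1 :=
          Equiv.sum_comp hσ.toPerm (fun q => f q.1 * g q.1)
      _ = _ := by
          rw [← Finset.univ_product_univ, Finset.sum_product]
          simp [Finset.mul_sum]
  unfold avg
  field_simp
  rw [mul_comm, ← key]

lemma avg_prod {κ : Type*} (J : Finset κ) (f : κ → (ι → Bool) → ℝ) (c : κ → Set ι)
    (hf : ∀ j ∈ J, DependsOn (f j) (c j)) (hc : (J : Set κ).PairwiseDisjoint c) :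
    avg (fun ω => ∏ j ∈ J, f j ω) = ∏ j ∈ J, avg (f j) := by
  classical
  induction J using Finset.induction_on with
  | empty => simp [avg_const]
  | insert a J ha ih =>
    simp only [Finset.prod_insert ha]
    rw [avg_mul (hf a (Finset.mem_insert_self _ _))
      (dependsOn_prod fun j hj => hf j (Finset.mem_insert_of_mem hj)),
      ih (fun j hj => hf j (Finset.mem_insert_of_mem hj))
        (hc.subset (by simp))]
    simp only [Set.disjoint_iUnion_right]
    intro j hj
    exact hc (by simp) (by simp [hj]) (fun h => ha (h ▸ hj))

lemma pr_eq_ncard (A : Set (ι → Bool)) : pr A = (A.ncard : ℝ) / 2 ^ Fintype.card ι := by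
  classical
  unfold pr avg
  congr 1
  simp only [Set.indicator_apply, Pi.one_apply, Finset.sum_boole]
  rw [Set.ncard_eq_toFinset_card', Set.filter_mem_univ_eq_toFinset]

lemma pr_mono {A B : Set (ι → Bool)} (h : A ⊆ B) : pr A ≤ pr B :=
  avg_mono fun ω => Set.indicator_le_indicator_of_subset h (fun _ => zero_le_one) ω

lemma pr_nonneg (A : Set (ι → Bool)) : 0 ≤ pr A := by
  rw [pr_eq_ncard]; positivity

lemma pr_univ : pr (Set.univ : Set (ι → Bool)) = 1 := by
  simp [pr, avg]

lemma pr_union_le (A B : Set (ι → Bool)) : pr (A ∪ B) ≤ pr A + pr B := by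
  simp only [pr_eq_ncard, ← add_div]
  gcongr
  exact_mod_cast Set.ncard_union_le A B

lemma pr_compl (A : Set (ι → Bool)) : pr Aᶜ = 1 - pr A := by
  rw [← pr_univ (ι := ι), eq_sub_iff_add_eq]
  unfold pr
  rw [← avg_add]
  congr 1
  ext ω
  by_cases h : ω ∈ A <;> simp [h]

lemma pr_le_add_pr_diff (A B : Set (ι → Bool)) : pr A ≤ pr B + pr (A \ B) :=
  (pr_mono (by simp)).trans (pr_union_le B (A \ B))

lemma pr_iUnion_le {κ : Type*} (J : Finset κ) (A : κ → Set (ι → Bool)) :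
    pr (⋃ j ∈ J, A j) ≤ ∑ j ∈ J, pr (A j) := by
  classical
  induction J using Finset.induction_on with
  | empty => simp [pr, avg]
  | insert a J ha ih =>
    rw [Finset.set_biUnion_insert, Finset.sum_insert ha]
    exact (pr_union_le _ _).trans (by gcongr)

lemma pr_inter {A B : Set (ι → Bool)} {s t : Set ι} (hA : DependsOn (· ∈ A) s)
    (hB : DependsOn (· ∈ B) t) (hst : Disjoint s t) : pr (A ∩ B) = pr A * pr B := by
  unfold pr
  rw [← avg_mul (dependsOn_indicator hA) (dependsOn_indicator hB) hst]
  congr 1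
  ext ω
  rw [Set.inter_indicator_one]; rfl

lemma pr_biInter {κ : Type*} (J : Finset κ) (A : κ → Set (ι → Bool)) (c : κ → Set ι)
    (hA : ∀ j ∈ J, DependsOn (· ∈ A j) (c j)) (hc : (J : Set κ).PairwiseDisjoint c) :
    pr (⋂ j ∈ J, A j) = ∏ j ∈ J, pr (A j) := by
  classical
  unfold pr
  rw [← avg_prod J _ c (fun j hj => dependsOn_indicator (hA j hj)) hc]
  congr 1
  ext ω
  by_cases h : ω ∈ ⋂ j ∈ J, A j
  · rw [Set.indicator_of_mem h, Finset.prod_eq_one]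
    · rfl
    · intro j hj
      rw [Set.indicator_of_mem (Set.mem_iInter₂.1 h j hj)]; rfl
  · rw [Set.indicator_of_notMem h]
    simp only [Set.mem_iInter, not_forall] at h
    obtain ⟨j, hj, hjA⟩ := h
    exact (Finset.prod_eq_zero hj (Set.indicator_of_notMem hjA _)).symm

lemma pr_bit (a : ι) (b : Bool) : pr {ω : ι → Bool | ω a = b} = 1 / 2 := by
  have h : pr {ω : ι → Bool | ω a = b} = pr {ω : ι → Bool | ω a = !b} := by
    simp only [pr_eq_ncard]
    congr 2
    -- Flipping the bit at `a` matches the two events.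
    refine Set.ncard_congr (fun ω _ => Function.update ω a (!b)) ?_ ?_ ?_
    · intro ω _; simp
    · intro ω ω' h h' he
      ext i
      have hi := congrFun he i
      by_cases hia : i = a
      · subst hia; exact h.trans h'.symm
      · simpa [Function.update_of_ne hia] using hi
    · intro ω h
      refine ⟨Function.update ω a b, by simp, ?_⟩
      simp only [Set.mem_ofPred_eq] at h
      simp [← h]
  have h2 : {ω : ι → Bool | ω a = !b} = {ω : ι → Bool | ω a = b}ᶜ := by
    ext ω; cases b <;> simp
  rw [h2, pr_compl] at h
  linarith

lemma pr_bits {κ : Type*} (J : Finset κ) (a : κ → ι) (ha : Set.InjOn a J) (b : κ → Bool) :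
    pr {ω : ι → Bool | ∀ j ∈ J, ω (a j) = b j} = (1 / 2) ^ J.card := by
  have : {ω : ι → Bool | ∀ j ∈ J, ω (a j) = b j} = ⋂ j ∈ J, {ω : ι → Bool | ω (a j) = b j} := by
    ext; simp
  rw [this, pr_biInter J _ (fun j => {a j}), Finset.prod_congr rfl fun j _ => pr_bit (a j) (b j)]
  · simp
  · intro j _ x y h
    simp [h (a j) rfl]
  · intro i hi j hj hij
    simpa using fun h => hij (ha hi hj h)

/-- The mean of a function of two bits. -/
lemma avg_two_bits {a b : ι} (hab : a ≠ b) (F : Bool → Bool → ℝ) :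
    avg (fun ω : ι → Bool => F (ω a) (ω b)) =
      (F true true + F true false + F false true + F false false) / 4 := by
  classical
  have h1 : ∀ α β : Bool, pr {ω : ι → Bool | ω a = α ∧ ω b = β} = 1 / 4 := by
    intro α β
    have := pr_inter (A := {ω : ι → Bool | ω a = α}) (B := {ω | ω b = β}) (s := {a}) (t := {b})
      (by intro x y h; simp [h a rfl]) (by intro x y h; simp [h b rfl]) (by simpa using hab)
    rw [pr_bit, pr_bit] at this
    rw [Set.ofPred_and, this]; norm_num
  have h2 : (fun ω : ι → Bool => F (ω a) (ω b)) = fun ω => ∑ α, ∑ β,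
      F α β * ({ω : ι → Bool | ω a = α ∧ ω b = β}.indicator 1 ω) := by
    ext ω
    simp only [Fintype.sum_bool]
    cases ha : ω a <;> cases hb : ω b <;> simp [ha, hb]
  rw [h2, avg_sum]
  simp_rw [avg_sum, avg_const_mul]
  have h3 : ∀ α β, avg ({ω : ι → Bool | ω a = α ∧ ω b = β}.indicator 1) = 1 / 4 := h1
  simp_rw [h3]
  simp only [Fintype.sum_bool]
  ring

lemma pr_two_bits {a b : ι} (hab : a ≠ b) (q : Bool → Bool → Prop) [∀ α β, Decidable (q α β)] :
    pr {ω : ι → Bool | q (ω a) (ω b)} = ((if q true true then 1 else 0) +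
      (if q true false then 1 else 0) + (if q false true then 1 else 0) +
        (if q false false then 1 else 0)) / 4 := by
  rw [← avg_two_bits hab (fun α β => if q α β then (1 : ℝ) else 0)]
  unfold pr
  congr 1
  ext ω
  by_cases h : q (ω a) (ω b) <;> simp [h]

/-- Markov's inequality for the exponential moment. -/
lemma pr_le_of_exp {f : (ι → Bool) → ℝ} {A : Set (ι → Bool)} {c : ℝ}
    (h : ∀ ω ∈ A, c ≤ f ω) : pr A ≤ Real.exp (-c) * avg (fun ω => Real.exp (f ω)) := by
  rw [← avg_const_mul]
  refine avg_mono fun ω => ?_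
  by_cases hω : ω ∈ A
  · rw [Set.indicator_of_mem hω, ← Real.exp_add, Pi.one_apply]
    exact Real.one_le_exp (by linarith [h ω hω])
  · rw [Set.indicator_of_notMem hω]; positivity

/-- A Chernoff bound for the number of disjoint pairs of bits that are both set. -/
lemma pr_double_count_le {κ : Type*} (J : Finset κ) (a b : κ → ι)
    (hab : ∀ j ∈ J, a j ≠ b j)
    (hd : (J : Set κ).PairwiseDisjoint fun j => ({a j, b j} : Set ι))
    (t : ℝ) (ht : |t| ≤ 1) (e : ℝ) :
    pr {ω : ι → Bool | e ≤ t * (({j ∈ J | ω (a j) ∧ ω (b j)}.card : ℝ) - (J.card : ℝ) / 4)} ≤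
      Real.exp (-e + t ^ 2 * J.card) := by
  classical
  let F : Bool → Bool → ℝ := fun α β => t * ((if α && β then 1 else 0) - 1 / 4)
  have hsum : ∀ ω : ι → Bool, t * (({j ∈ J | ω (a j) ∧ ω (b j)}.card : ℝ) - (J.card : ℝ) / 4) =
      ∑ j ∈ J, F (ω (a j)) (ω (b j)) := by
    intro ω
    simp only [F, ← Finset.mul_sum, Finset.sum_sub_distrib, Finset.sum_const, nsmul_eq_mul]
    congr 2
    · simp
    · ring
  refine (pr_le_of_exp (f := fun ω => ∑ j ∈ J, F (ω (a j)) (ω (b j))) (c := e)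
    fun ω hω => ?_).trans ?_
  · rw [← hsum]; exact hω
  simp_rw [Real.exp_sum]
  rw [avg_prod J _ (fun j => ({a j, b j} : Set ι)) _ hd, Real.exp_add]
  · gcongr
    rw [mul_comm, Real.exp_nat_mul, ← Finset.prod_const]
    refine Finset.prod_le_prod (fun j hj => ?_) fun j hj => ?_
    · unfold avg; positivity
    rw [avg_two_bits (hab j hj) (fun α β => Real.exp (F α β))]
    -- With `exp x ≤ 1 + x + x²` at both values of the centred variable, the linear terms cancel in
    -- the mean, leaving at most `1 + t² ≤ exp (t²)` per pair.
    have h1 := Real.abs_exp_sub_one_sub_id_le (x := t * (3 / 4))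
      (by rw [abs_mul, abs_of_pos (by norm_num : (0 : ℝ) < 3 / 4)]; linarith)
    have h2 := Real.abs_exp_sub_one_sub_id_le (x := t * (-1 / 4))
      (by rw [abs_mul]; norm_num; linarith)
    have h3 := (abs_le.1 h1).2
    have h4 := (abs_le.1 h2).2
    have h5 := Real.add_one_le_exp (t ^ 2)
    simp only [F, Bool.and_self, Bool.and_false, Bool.and_true, if_true]
    norm_num at h3 h4 ⊢
    nlinarith
  · intro j hj x y h
    simp [h (a j) (by simp), h (b j) (by simp)]

end Bits

/-! ### Bounds on the numbers of blank edges of a coloring -/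

/-- The double edges between the un-looped nodes and `S`. -/
def doubleEdges {V : Type*} (G : Digraph V) (S : Set V) : Set (V × V) :=
  {e | ¬ Looped G e.1 ∧ e.2 ∈ S ∧ Double G e.1 e.2}

namespace TypedColoring

variable {V : Type*} {G : Digraph V} {χ : TypedColoring G}

lemma looped_of_mem_blankNodes {x : V} (hx : x ∈ χ.blankNodes) : Looped G x := by
  by_contra h
  have h1 := (χ.absent_iff x x).2 h
  have h2 : χ.color x x = Color.blank := hx
  rw [h1] at h2
  cases h2

lemma adj_of_blank {x y : V} (h : χ.Blank x y) : G.Adj x y := by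
  by_contra h1
  have h2 := (χ.absent_iff x y).2 h1
  have h3 : χ.color x y = Color.blank := h
  rw [h2] at h3
  cases h3

lemma mem_unloopedZero_of_mem_gridRegion {x : V} (hx : x ∈ χ.gridRegion) (hl : ¬ Looped G x) :
    x ∈ unloopedZero G χ.blankNodes := by
  rcases hx with (h | h) | h
  · exact h
  · exact absurd h.1 hl
  · exact absurd (looped_of_mem_blankNodes h.1) hl

lemma notMem_blankNodes_of_not_looped {x : V} (hl : ¬ Looped G x) : x ∉ χ.blankNodes :=
  fun h => hl (looped_of_mem_blankNodes h)

/-- Non-loop edges within `T̃` are green, so only the loops are blank. -/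
lemma ncard_blank_loops (hA : χ.ConstraintA) :
    {e : V × V | e.1 ∈ χ.blankNodes ∧ e.2 ∈ χ.blankNodes ∧ χ.Blank e.1 e.2}.ncard =
      χ.blankNodes.ncard := by
  have h : {e : V × V | e.1 ∈ χ.blankNodes ∧ e.2 ∈ χ.blankNodes ∧ χ.Blank e.1 e.2} =
      (fun x => (x, x)) '' χ.blankNodes := by
    ext ⟨x, y⟩
    constructor
    · rintro ⟨hx, hy, hb⟩
      by_cases hxy : x = y
      · subst hxy; exact ⟨x, hx, rfl⟩
      · have h1 := hA.2 x hx y hy hxy (adj_of_blank hb)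
        have h2 : χ.color x y = Color.blank := hb
        rw [h1] at h2; cases h2
    · rintro ⟨z, hz, he⟩
      simp only [Prod.mk.injEq] at he
      obtain ⟨rfl, rfl⟩ := he
      exact ⟨hz, hz, hz⟩
  rw [h]
  exact Set.ncard_image_of_injective _ fun x y h => congrArg Prod.fst h

/-- Lets blanks be counted as directed links; it applies to every type except `v` and `K`, whose
backward edge may also be blank. -/
lemma blanksIn_eq_of_forward {τ : LinkType}
    (hτ : ∀ x y, χ.link τ x y → χ.Blank x y ∧ ¬ χ.Blank y x) :
    χ.blanksIn τ = {e : V × V | χ.link τ e.1 e.2}.ncard := by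
  unfold blanksIn
  congr 1
  ext ⟨x, y⟩
  constructor
  · rintro ⟨hb, h | h⟩
    · exact h
    · exact absurd hb (hτ y x h).2
  · intro h
    exact ⟨(hτ x y h).1, Or.inl h⟩

lemma not_blank_of_eq {x y : V} {c : Color} (h : χ.color x y = c) (hc : c ≠ .blank) :
    ¬ χ.Blank x y := fun h' => hc (h.symm.trans h')

variable [Finite V]

/-- At most one outgoing link of a grid type per node of `U_0`. -/
lemma ncard_link_fst_le (hB : χ.ConstraintB) {τ : LinkType}
    (hτ : τ = .h ∨ τ = .v ∨ τ = .d₁ ∨ τ = .d₂) :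
    {e : V × V | ¬ Looped G e.1 ∧ χ.link τ e.1 e.2}.ncard ≤
      (unloopedZero G χ.blankNodes).ncard := by
  refine Set.ncard_le_ncard_of_injOn Prod.fst ?_ ?_ (Set.toFinite _)
  · rintro ⟨x, y⟩ ⟨hl, h⟩
    exact mem_unloopedZero_of_mem_gridRegion (hB.2.2.2 τ hτ x y h).1 hl
  · rintro ⟨x, y⟩ ⟨hl, h⟩ ⟨x', y'⟩ ⟨_, h'⟩ (rfl : x = x')
    have := (hB.2.1 τ (by rintro rfl; simp at hτ) (by rintro rfl; simp at hτ) x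
      (notMem_blankNodes_of_not_looped hl) y y').1 h h'
    rw [this]

lemma ncard_link_snd_le (hB : χ.ConstraintB) {τ : LinkType}
    (hτ : τ = .h ∨ τ = .v ∨ τ = .d₁ ∨ τ = .d₂) :
    {e : V × V | ¬ Looped G e.2 ∧ χ.link τ e.1 e.2}.ncard ≤
      (unloopedZero G χ.blankNodes).ncard := by
  refine Set.ncard_le_ncard_of_injOn Prod.snd ?_ ?_ (Set.toFinite _)
  · rintro ⟨x, y⟩ ⟨hl, h⟩
    exact mem_unloopedZero_of_mem_gridRegion (hB.2.2.2 τ hτ x y h).2 hl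
  · rintro ⟨x, y⟩ ⟨hl, h⟩ ⟨x', y'⟩ ⟨_, h'⟩ (rfl : y = y')
    have := (hB.2.1 τ (by rintro rfl; simp at hτ) (by rintro rfl; simp at hτ) y
      (notMem_blankNodes_of_not_looped hl) x x').2 h h'
    rw [this]

/-- Each link is charged to its un-looped end. That end lies in `U_0` and is not blank, so it has at
most one outgoing and one incoming link; the sink of `T̃` never has to be charged. -/
lemma blanksIn_h_le (hB : χ.ConstraintB) :
    χ.blanksIn .h ≤ 2 * (unloopedZero G χ.blankNodes).ncard := by
  rw [blanksIn_eq_of_forward (τ := .h) fun x y h => ⟨(χ.pattern _ _ _ h).2.1,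
    not_blank_of_eq (χ.pattern _ _ _ h).2.2 (by simp)⟩]
  have hsub : {e : V × V | χ.link .h e.1 e.2} ⊆
      {e : V × V | ¬ Looped G e.1 ∧ χ.link .h e.1 e.2} ∪
        {e : V × V | ¬ Looped G e.2 ∧ χ.link .h e.1 e.2} := by
    rintro ⟨x, y⟩ h
    have ha : Looped G x ↔ ¬ Looped G y := (χ.pattern _ _ _ h).1
    by_cases hx : Looped G x
    · exact Or.inr ⟨ha.1 hx, h⟩
    · exact Or.inl ⟨hx, h⟩
  have h1 := (Set.ncard_le_ncard hsub).trans (Set.ncard_union_le _ _)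
  have h2 := ncard_link_fst_le hB (τ := .h) (by simp)
  have h3 := ncard_link_snd_le hB (τ := .h) (by simp)
  omega

/-- The charging is that of type `h`, but a link may contribute two blanks; the swapped copies of
`P` and `Q` account for the backward edges. -/
lemma blanksIn_v_le (hB : χ.ConstraintB) :
    χ.blanksIn .v ≤ 4 * (unloopedZero G χ.blankNodes).ncard := by
  set P := {e : V × V | ¬ Looped G e.1 ∧ χ.link .v e.1 e.2}
  set Q := {e : V × V | ¬ Looped G e.2 ∧ χ.link .v e.1 e.2}
  have hsub : {e : V × V | χ.Blank e.1 e.2 ∧ (χ.link .v e.1 e.2 ∨ χ.link .v e.2 e.1)} ⊆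
      (P ∪ Q) ∪ (Prod.swap '' P ∪ Prod.swap '' Q) := by
    have hPQ : ∀ x y, χ.link .v x y → (x, y) ∈ P ∪ Q := by
      intro x y h
      have ha : Looped G x ↔ ¬ Looped G y := (χ.pattern _ _ _ h).1
      by_cases hx : Looped G x
      · exact Or.inr ⟨ha.1 hx, h⟩
      · exact Or.inl ⟨hx, h⟩
    rintro ⟨x, y⟩ ⟨-, h | h⟩
    · exact Or.inl (hPQ x y h)
    · rw [← Set.image_union]
      exact Or.inr ⟨(y, x), hPQ y x h, rfl⟩
  have h1 := Set.ncard_le_ncard hsub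
  have h2 := Set.ncard_union_le (P ∪ Q) (Prod.swap '' P ∪ Prod.swap '' Q)
  have h3 := Set.ncard_union_le P Q
  have h4 := Set.ncard_union_le (Prod.swap '' P) (Prod.swap '' Q)
  rw [Set.ncard_image_of_injective _ Prod.swap_injective,
    Set.ncard_image_of_injective _ Prod.swap_injective] at h4
  have h5 : P.ncard ≤ _ := ncard_link_fst_le hB (τ := .v) (by simp)
  have h6 : Q.ncard ≤ _ := ncard_link_snd_le hB (τ := .v) (by simp)
  unfold blanksIn
  omega

lemma blanksIn_d₁_le (hB : χ.ConstraintB) :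
    χ.blanksIn .d₁ ≤ (unloopedZero G χ.blankNodes).ncard := by
  rw [blanksIn_eq_of_forward (τ := .d₁) fun x y h => ⟨(χ.pattern _ _ _ h).2.2.1,
    not_blank_of_eq (χ.pattern _ _ _ h).2.2.2 (by simp)⟩]
  refine le_trans (Set.ncard_le_ncard ?_) (ncard_link_fst_le hB (τ := .d₁) (by simp))
  exact fun e h => ⟨(χ.pattern _ _ _ h).1, h⟩

lemma blanksIn_d₂_le (hB : χ.ConstraintB) :
    χ.blanksIn .d₂ ≤ (unloopedZero G χ.blankNodes).ncard := by
  rw [blanksIn_eq_of_forward (τ := .d₂) fun x y h => ⟨(χ.pattern _ _ _ h).2.2.1,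
    not_blank_of_eq (χ.pattern _ _ _ h).2.2.2 (by simp)⟩]
  refine le_trans (Set.ncard_le_ncard ?_) (ncard_link_fst_le hB (τ := .d₂) (by simp))
  exact fun e h => ⟨(χ.pattern _ _ _ h).1, h⟩

lemma ncard_link_K_le (hB : χ.ConstraintB) (hC : χ.ConstraintC) :
    {e : V × V | χ.link .K e.1 e.2}.ncard ≤ (unloopedConn G χ.blankNodes).ncard := by
  refine Set.ncard_le_ncard_of_injOn Prod.fst ?_ ?_ (Set.toFinite _)
  · rintro ⟨x, y⟩ h
    exact (hC x y h).1
  · rintro ⟨x, y⟩ h ⟨x', y'⟩ h' (rfl : x = x')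
    have := hB.1 .K (Or.inl rfl) x (notMem_blankNodes_of_not_looped (hC x y h).1.1) y y'
      (Or.inl h) (Or.inl h')
    rw [this]

/-- Links are charged to their targets: the pattern keeps a target out of `T̃`, hence within `U_T̃ ∪
L_T̃`, and it has only one incoming link. -/
lemma blanksIn_I_le (hB : χ.ConstraintB) :
    χ.blanksIn .I ≤ (unloopedConn G χ.blankNodes).ncard + (loopedConn G χ.blankNodes).ncard := by
  rw [blanksIn_eq_of_forward (τ := .I) fun x y h => ⟨(χ.pattern _ _ _ h).2.2.1, by
    rcases (χ.pattern _ _ _ h).2.2.2 with h | h | h <;> exact not_blank_of_eq h (by simp)⟩]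
  refine le_trans ?_ (Set.ncard_union_le _ _)
  refine Set.ncard_le_ncard_of_injOn Prod.snd ?_ ?_ (Set.toFinite _)
  · rintro ⟨x, y⟩ h
    exact (hB.2.2.1 x y h).2.resolve_right (χ.pattern _ _ _ h).2.1
  · rintro ⟨x, y⟩ h ⟨x', y'⟩ h' (rfl : y = y')
    have := (hB.2.1 .I (by simp) (by simp) y (χ.pattern _ _ _ h).2.1 x x').2 h h'
    rw [this]

/-- At least one end of an `M`-link is outside `T̃`; `f` selects such an end. It lies in `L_T̃` and
has a single `M`-link, and `directed` excludes the same link read backwards, so `f` is injective on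
links. -/
lemma blanksIn_M_le (hB : χ.ConstraintB) (hD : χ.ConstraintD) :
    χ.blanksIn .M ≤ (loopedConn G χ.blankNodes).ncard := by
  classical
  rw [blanksIn_eq_of_forward (τ := .M) fun x y h => ⟨(χ.pattern _ _ _ h).2.2.2.1,
    (χ.pattern _ _ _ h).2.2.2.2⟩]
  let f : V × V → V := fun e => if e.1 ∈ χ.blankNodes then e.2 else e.1
  have hf : ∀ x y, χ.link .M x y → f (x, y) ∉ χ.blankNodes ∧
      ∃ w, (x, y) = (f (x, y), w) ∨ (x, y) = (w, f (x, y)) := by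
    intro x y h
    have hn := (χ.pattern _ _ _ h).2.2.1
    by_cases hx : x ∈ χ.blankNodes
    · simp only [f, hx, if_true]
      exact ⟨fun hy => hn ⟨hx, hy⟩, x, Or.inr rfl⟩
    · simp only [f, hx, if_false]
      exact ⟨not_false, y, Or.inl rfl⟩
  refine Set.ncard_le_ncard_of_injOn f ?_ ?_ (Set.toFinite _)
  · rintro ⟨x, y⟩ h
    obtain ⟨h1, w, h2 | h2⟩ := hf x y h
    · have h3 : f (x, y) = x := (congrArg Prod.fst h2).symm
      rw [h3] at h1 ⊢
      exact (hD x y h).1.resolve_right h1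
    · have h3 : f (x, y) = y := (congrArg Prod.snd h2).symm
      rw [h3] at h1 ⊢
      exact (hD x y h).2.resolve_right h1
  · rintro ⟨x, y⟩ h ⟨x', y'⟩ h' he
    obtain ⟨h1, w, h2⟩ := hf x y h
    obtain ⟨-, w', h3⟩ := hf x' y' h'
    rw [← he] at h3
    generalize f (x, y) = z at *
    simp only [Prod.mk.injEq] at h2 h3
    have key := hB.1 .M (Or.inr rfl) z h1 w w'
    rcases h2 with ⟨rfl, rfl⟩ | ⟨rfl, rfl⟩ <;> rcases h3 with ⟨rfl, rfl⟩ | ⟨rfl, rfl⟩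
    · rw [key (Or.inl h) (Or.inl h')]
    · obtain rfl := key (Or.inl h) (Or.inr h')
      exact absurd h' (χ.directed _ _ _ _ h)
    · obtain rfl := key (Or.inr h) (Or.inl h')
      exact absurd h' (χ.directed _ _ _ _ h)
    · rw [key (Or.inr h) (Or.inr h')]

lemma bTilde_le (hA : χ.ConstraintA) (hB : χ.ConstraintB) (hC : χ.ConstraintC)
    (hD : χ.ConstraintD) (i : Fin 9) :
    χ.bTilde i ≤ ![χ.blankNodes.ncard, 2 * (unloopedZero G χ.blankNodes).ncard,
      4 * (unloopedZero G χ.blankNodes).ncard, (unloopedZero G χ.blankNodes).ncard,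
      (unloopedZero G χ.blankNodes).ncard, (unloopedConn G χ.blankNodes).ncard,
      (unloopedConn G χ.blankNodes).ncard + (loopedConn G χ.blankNodes).ncard,
      (loopedConn G χ.blankNodes).ncard, (doubleEdges G χ.blankNodes).ncard] i := by
  fin_cases i
  · exact (ncard_blank_loops hA).le
  · exact blanksIn_h_le hB
  · exact blanksIn_v_le hB
  · exact blanksIn_d₁_le hB
  · exact blanksIn_d₂_le hB
  · exact ncard_link_K_le hB hC
  · exact blanksIn_I_le hB
  · exact blanksIn_M_le hB hD
  · exact Set.ncard_le_ncard fun e h => ⟨h.1, h.2.1, h.2.2.1⟩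

lemma sum_bTilde_le (hA : χ.ConstraintA) (hB : χ.ConstraintB) (hC : χ.ConstraintC)
    (hD : χ.ConstraintD) :
    ∑ i, χ.bTilde i ≤ χ.blankNodes.ncard + 8 * (unloopedZero G χ.blankNodes).ncard +
      2 * (unloopedConn G χ.blankNodes).ncard + 2 * (loopedConn G χ.blankNodes).ncard +
      (doubleEdges G χ.blankNodes).ncard := by
  refine (Finset.sum_le_sum fun i _ => bTilde_le hA hB hC hD i).trans (le_of_eq ?_)
  simp only [Fin.sum_univ_succ, Fin.sum_univ_zero, Matrix.cons_val_zero, Matrix.cons_val_succ]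
  ring

end TypedColoring

/-! ### A quasirandomness condition that forces the blank edges -/

/-- The edges between the node set `U`, of about `n` nodes, and sets of about `k` nodes outside `U`
are distributed as in a random digraph. -/
structure Quasirandom {V : Type*} (G : Digraph V) (U : Set V) (n k : ℕ) : Prop where
  double : ∀ x ∉ U, |({u ∈ U | Double G u x}.ncard : ℝ) - (n : ℝ) / 4| ≤ (n : ℝ) / (16 * k)
  conn : ∀ S ⊆ Uᶜ, ∀ W, Disjoint W S → k ≤ 2 * S.ncard → n ≤ 100 * W.ncard →
    ∃ w ∈ W, ∃ s ∈ S, ¬ Connected G w s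
  single : ∀ S ⊆ Uᶜ, ∀ W, Disjoint W S → k ≤ 2 * S.ncard → n ≤ 100 * W.ncard →
    ∃ w ∈ W, ∃ s ∈ S, G.Adj w s ∧ ¬ G.Adj s w

section

variable {V : Type*} {G : Digraph V}

lemma IsTournament.subset {S S' : Set V} (hS : IsTournament G S) (h : S' ⊆ S) :
    IsTournament G S' :=
  ⟨fun x hx => hS.1 x (h hx), fun x hx y hy => hS.2.1 x (h hx) y (h hy),
    fun x hx y hy z hz => hS.2.2 x (h hx) y (h hy) z (h hz)⟩

lemma isTournament_subset_compl_unlooped {S : Set V} (hS : IsTournament G S) :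
    S ⊆ (unlooped G)ᶜ := fun x hx h => h (hS.1 x hx)

variable [Finite V]

/-- If there is only one tournament with `k` nodes, then all others are smaller. -/
lemma ncard_lt_of_unique_tournament {k : ℕ} (hk : 0 < k) {T S : Set V}
    (hT : {S | IsTournament G S ∧ S.ncard = k} = {T}) (hS : IsTournament G S) (hST : S ≠ T) :
    S.ncard < k := by
  have huniq : ∀ S', IsTournament G S' → S'.ncard = k → S' = T := fun S' h1 h2 => by
    have : S' ∈ {S | IsTournament G S ∧ S.ncard = k} := ⟨h1, h2⟩
    rwa [hT] at this
  by_contra! hlt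
  have hTk : T.ncard = k := by
    have : T ∈ {S | IsTournament G S ∧ S.ncard = k} := by rw [hT]; rfl
    exact this.2
  -- Subsets of tournaments are tournaments, so `T` would be the only `k`-subset of `S`. Exchanging
  -- a node of `T` for one of `S` outside `T` gives another.
  have hex : ∀ S' ⊆ S, S'.ncard = k → S' = T := fun S' h => huniq S' (hS.subset h)
  obtain ⟨T', hT'S, hT'⟩ := Set.exists_subset_card_eq hlt
  obtain rfl := hex T' hT'S hT'
  obtain ⟨y, hyS, hyT⟩ := Set.exists_of_ssubset (hT'S.ssubset_of_ne hST.symm)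
  obtain ⟨x, hx⟩ : T'.Nonempty := by
    rw [← Set.ncard_pos]; omega
  have h2 := hex (insert y (T' \ {x})) ?_ ?_
  · exact hyT (h2 ▸ Set.mem_insert _ _)
  · exact Set.insert_subset hyS (Set.sdiff_subset.trans hT'S)
  · rw [Set.ncard_insert_of_notMem (fun h => hyT h.1), Set.ncard_sdiff_singleton_add_one hx, hT']

lemma ncard_doubleEdges (S : Set V) :
    ((doubleEdges G S).ncard : ℝ) =
      ∑ x ∈ (Set.toFinite S).toFinset, ({u ∈ unlooped G | Double G u x}.ncard : ℝ) := by
  classical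
  have h : doubleEdges G S = ⋃ x ∈ (Set.toFinite S).toFinset,
      (fun u => (u, x)) '' {u ∈ unlooped G | Double G u x} := by
    ext ⟨u, x⟩
    simp only [doubleEdges, Set.mem_iUnion, Set.Finite.mem_toFinset, Set.mem_image, unlooped]
    constructor
    · rintro ⟨h1, h2, h3⟩
      exact ⟨x, h2, u, ⟨h1, h3⟩, rfl⟩
    · rintro ⟨y, hy, v, ⟨h1, h2⟩, h3⟩
      simp only [Prod.mk.injEq] at h3
      obtain ⟨rfl, rfl⟩ := h3
      exact ⟨h1, hy, h2⟩
  rw [h, ← Nat.cast_sum]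
  congr 1
  have h1 : (⋃ x ∈ (Set.toFinite S).toFinset,
      (fun u => (u, x)) '' {u ∈ unlooped G | Double G u x}) =
      ((Set.toFinite S).toFinset.biUnion fun x =>
        (Set.toFinite ((fun u => (u, x)) '' {u ∈ unlooped G | Double G u x})).toFinset :
          Finset (V × V)) := by
    simp
  rw [h1, Set.ncard_coe_finset, Finset.card_biUnion]
  · refine Finset.sum_congr rfl fun x _ => ?_
    rw [← Set.ncard_eq_toFinset_card]
    exact Set.ncard_image_of_injective _ fun u v h => congrArg Prod.fst h
  · intro x _ y _ hxy
    rw [Function.onFun, Finset.disjoint_left]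
    rintro ⟨a, b⟩ h1 h2
    simp only [Set.Finite.mem_toFinset, Set.mem_image, Prod.mk.injEq] at h1 h2
    obtain ⟨_, _, _, rfl⟩ := h1
    obtain ⟨_, _, _, rfl⟩ := h2
    exact hxy rfl

lemma Quasirandom.abs_ncard_doubleEdges_sub_le {n k : ℕ} (hG : Quasirandom G (unlooped G) n k)
    {S : Set V} (hS : S ⊆ (unlooped G)ᶜ) :
    |((doubleEdges G S).ncard : ℝ) - S.ncard * ((n : ℝ) / 4)| ≤ S.ncard * ((n : ℝ) / (16 * k)) := by
  rw [ncard_doubleEdges, Set.ncard_eq_toFinset_card S, ← nsmul_eq_mul, ← nsmul_eq_mul,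
    ← Finset.sum_const, ← Finset.sum_const, ← Finset.sum_sub_distrib]
  refine (Finset.abs_sum_le_sum_abs _ _).trans (Finset.sum_le_sum fun x hx => ?_)
  exact hG.double x (hS ((Set.Finite.mem_toFinset _).1 hx))

lemma ncard_unloopedZero_le (S : Set V) : (unloopedZero G S).ncard ≤ (unlooped G).ncard :=
  Set.ncard_le_ncard fun _ h => h.1

lemma ncard_unloopedConn_le (S : Set V) : (unloopedConn G S).ncard ≤ (unlooped G).ncard :=
  Set.ncard_le_ncard fun _ h => h.1

/-- This crude bound and the two before it serve for tournaments with fewer than `k/2` nodes. -/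
lemma ncard_loopedConn_add_le (S : Set V) :
    (loopedConn G S).ncard + (unlooped G).ncard ≤ Nat.card V := by
  have h : Disjoint (loopedConn G S) (unlooped G) :=
    Set.disjoint_left.2 fun x h1 h2 => h2 h1.1
  rw [← Set.ncard_union_eq h, ← Set.ncard_univ]
  exact Set.ncard_le_ncard (Set.subset_univ _)

/-- In a quasirandom digraph a tournament that is too small leaves too few blank edges. -/
lemma Quasirandom.weight_lt {n k : ℕ} (hG : Quasirandom G (unlooped G) n k) (hk : 200 ≤ k)
    (hn : 100 ≤ n) (hU : (unlooped G).ncard = n) (hV : Nat.card V ≤ 2 * n + k) {S T : Set V}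
    (hS : IsTournament G S) (hT : IsTournament G T) (hTk : T.ncard = k) (hSk : S.ncard < k) :
    S.ncard + 8 * (unloopedZero G S).ncard + 2 * (unloopedConn G S).ncard +
      2 * (loopedConn G S).ncard + (doubleEdges G S).ncard < k + (doubleEdges G T).ncard := by
  have hkR : (200 : ℝ) ≤ k := by exact_mod_cast hk
  have hnR : (100 : ℝ) ≤ n := by exact_mod_cast hn
  have hSR : (S.ncard : ℝ) + 1 ≤ k := by exact_mod_cast hSk
  have h1 := (abs_le.1 (hG.abs_ncard_doubleEdges_sub_le
    (isTournament_subset_compl_unlooped hS))).2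
  have h2 := (abs_le.1 (hG.abs_ncard_doubleEdges_sub_le
    (isTournament_subset_compl_unlooped hT))).1
  rw [hTk] at h2
  -- The deviations of at most `n/(16k)` per node add up to at most `n/16` for each of `S` and `T`.
  -- So `T` has at least `(k - m)n/4 - n/8` more double edges than `S`.
  have h3 : (k : ℝ) * ((n : ℝ) / (16 * k)) = n / 16 := by field_simp
  have h4 : (S.ncard : ℝ) * ((n : ℝ) / (16 * k)) ≤ n / 16 := by
    rw [← h3]; gcongr
  have h0 := ncard_unloopedZero_le (G := G) S
  have hc := ncard_unloopedConn_le (G := G) S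
  have hl := ncard_loopedConn_add_le (G := G) S
  set m := S.ncard
  set a := (unloopedZero G S).ncard
  set b := (unloopedConn G S).ncard
  set c := (loopedConn G S).ncard
  have goal : (m : ℝ) + 8 * a + 2 * b + 2 * c + (doubleEdges G S).ncard <
      k + (doubleEdges G T).ncard := by
    -- For `2m < k` the surplus exceeds `kn/8 - n/8`, which beats `8n + 2n + 2(n + k)` since `k ≥
    -- 200` and `n ≥ 100`. Otherwise the surplus is at least `n/8`, while the three classes
    -- contribute less than `(8 + 2 + 2)n/100`.
    rcases lt_or_ge (2 * m) k with hm | hm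
    · have ha : (a : ℝ) ≤ n := by exact_mod_cast h0.trans hU.le
      have hb : (b : ℝ) ≤ n := by exact_mod_cast hc.trans hU.le
      have hcn : (c : ℝ) ≤ n + k := by
        have : c ≤ n + k := by omega
        exact_mod_cast this
      have hmR : 2 * (m : ℝ) < k := by exact_mod_cast hm
      nlinarith
    · have hsub := isTournament_subset_compl_unlooped hS
      have ha : 100 * a < n := by
        by_contra! h
        obtain ⟨w, hw, s, hs, h5⟩ := hG.single S hsub (unloopedZero G S)
          (Set.disjoint_left.2 fun x h6 h7 => h6.1 (hS.1 x h7)) hm h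
        exact hw.2 s hs h5
      have hb : 100 * b < n := by
        by_contra! h
        obtain ⟨w, hw, s, hs, h5⟩ := hG.conn S hsub (unloopedConn G S)
          (Set.disjoint_left.2 fun x h6 h7 => h6.1 (hS.1 x h7)) hm h
        exact h5 (hw.2 s hs)
      have hcc : 100 * c < n := by
        by_contra! h
        obtain ⟨w, hw, s, hs, h5⟩ := hG.conn S hsub (loopedConn G S)
          (Set.disjoint_left.2 fun x h6 h7 => h6.2.1 h7) hm h
        exact h5 (hw.2.2 s hs)
      have haR : 100 * (a : ℝ) < n := by exact_mod_cast ha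
      have hbR : 100 * (b : ℝ) < n := by exact_mod_cast hb
      have hcR : 100 * (c : ℝ) < n := by exact_mod_cast hcc
      nlinarith
  exact_mod_cast goal

end

lemma eq_of_le_of_sum_le {b c : Fin 9 → ℕ} (h : ∀ i, c i ≤ b i)
    (hsum : ∑ i, b i ≤ ∑ i, c i) (i : Fin 9) : c i = b i := by
  have := (Finset.sum_eq_sum_iff_of_le fun i _ => h i).1
    (le_antisymm (Finset.sum_le_sum fun i _ => h i) hsum)
  exact this i (Finset.mem_univ i)

/-- The sizes that define `𝒩` and quasirandomness force the blank edges. -/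
theorem blanksForced_of_quasirandom {p : ℕ} {G : Digraph (Fin (numNodes p))}
    {T : Set (Fin (numNodes p))} (hT : {S | IsTournament G S ∧ S.ncard = kOf p} = {T})
    (hU : (unlooped G).ncard = nOf p) (h0 : (unloopedZero G T).ncard = 2 * p ^ 2)
    (hUT : (unloopedConn G T).ncard = 2 * p ^ 2)
    (hLT : (loopedConn G T).ncard + 1 = 2 * p ^ 2) (hk : 200 ≤ kOf p) (hn : 100 ≤ nOf p)
    (hG : Quasirandom G (unlooped G) (nOf p) (kOf p)) : BlanksForced G p := by
  intro T' hT' hT'k χ hA hB hC hD hsum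
  obtain rfl : T' = T := by
    have : T' ∈ {S | IsTournament G S ∧ S.ncard = kOf p} := ⟨hT', hT'k⟩
    rwa [hT] at this
  have hTeq : χ.blankNodes = T' := by
    by_contra hne
    have hlt := ncard_lt_of_unique_tournament (by omega) hT hA.1 hne
    have hw := hG.weight_lt hk hn hU (by simp [numNodes]) hA.1 hT' hT'k hlt
    have h1 := hsum.trans (TypedColoring.sum_bTilde_le hA hB hC hD)
    simp only [bound, Fin.sum_univ_succ, Fin.sum_univ_zero, Matrix.cons_val_zero,
      Matrix.cons_val_succ] at h1
    unfold doubleEdges at *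
    omega
  have hle : ∀ i, χ.bTilde i ≤ bound G T' p i := by
    intro i
    refine (TypedColoring.bTilde_le hA hB hC hD i).trans (le_of_eq ?_)
    rw [hTeq, h0, hUT, hT'k]
    have h6 : 2 * p ^ 2 + (loopedConn G T').ncard = 4 * p ^ 2 - 1 := by omega
    have h7 : (loopedConn G T').ncard = 2 * p ^ 2 - 1 := by omega
    rw [h6, h7, show 2 * (2 * p ^ 2) = 4 * p ^ 2 by ring,
      show 4 * (2 * p ^ 2) = 8 * p ^ 2 by ring]
    rfl
  exact ⟨hTeq, hle, eq_of_le_of_sum_le hle hsum⟩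

/-! ### Random digraphs are quasirandom -/

/-- The digraph given by its adjacency bits. -/
def ofBits {V : Type*} (ω : V × V → Bool) : Digraph V := ⟨fun x y => ω (x, y) = true⟩

section

variable {V : Type*}

/-- All pairs read by the condition join disjoint sets, so no loop is involved. This makes
quasirandomness with respect to a fixed `U` independent of the event that `U` is the set of
un-looped nodes. -/
lemma dependsOn_quasirandom (U : Set V) (n k : ℕ) :
    DependsOn (· ∈ {ω : V × V → Bool | ¬ Quasirandom (ofBits ω) U n k}) {e | e.1 ≠ e.2} := by
  have key : ∀ ω ω' : V × V → Bool, (∀ e ∈ {e : V × V | e.1 ≠ e.2}, ω e = ω' e) →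
      Quasirandom (ofBits ω) U n k → Quasirandom (ofBits ω') U n k := by
    intro ω ω' h hq
    have hadj : ∀ x y, x ≠ y → ((ofBits ω).Adj x y ↔ (ofBits ω').Adj x y) := fun x y hxy => by
      simp only [ofBits]
      rw [h (x, y) hxy]
    have hne : ∀ {S W : Set V} {w s : V}, Disjoint W S → w ∈ W → s ∈ S → w ≠ s := by
      rintro S W w s hd hw hs rfl
      exact Set.disjoint_left.1 hd hw hs
    refine ⟨fun x hx => ?_, fun S hS W hW h1 h2 => ?_, fun S hS W hW h1 h2 => ?_⟩
    · have := hq.double x hx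
      have he : {u ∈ U | Double (ofBits ω') u x} = {u ∈ U | Double (ofBits ω) u x} := by
        ext u
        refine and_congr_right fun hu => ?_
        have hux : u ≠ x := fun h => hx (h ▸ hu)
        exact and_congr (hadj u x hux).symm (hadj x u hux.symm).symm
      rwa [he]
    · obtain ⟨w, hw, s, hs, h3⟩ := hq.conn S hS W hW h1 h2
      have hws := hne hW hw hs
      refine ⟨w, hw, s, hs, fun h4 => h3 ?_⟩
      exact h4.imp (hadj w s hws).2 (hadj s w hws.symm).2
    · obtain ⟨w, hw, s, hs, h3, h4⟩ := hq.single S hS W hW h1 h2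
      have hws := hne hW hw hs
      exact ⟨w, hw, s, hs, (hadj w s hws).1 h3, fun h => h4 ((hadj s w hws.symm).2 h)⟩
  intro ω ω' h
  simp only [Set.mem_ofPred_eq, eq_iff_iff, not_iff_not]
  exact ⟨key ω ω' h, key ω' ω fun e he => (h e he).symm⟩

variable [Fintype V] [DecidableEq V]

/-- Since `W` and `S` are disjoint, distinct pairs in `W × S` use disjoint pairs of opposite edges,
hence independent bits. -/
lemma pr_forall_pairs {W S : Finset V} (hd : Disjoint W S) (q : Bool → Bool → Prop) {r : ℝ}
    (hq : ∀ a b : V × V, a ≠ b → pr {ω : V × V → Bool | q (ω a) (ω b)} = r) :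
    pr {ω : V × V → Bool | ∀ w ∈ W, ∀ s ∈ S, q (ω (w, s)) (ω (s, w))} =
      r ^ (W.card * S.card) := by
  have h : {ω : V × V → Bool | ∀ w ∈ W, ∀ s ∈ S, q (ω (w, s)) (ω (s, w))} =
      ⋂ e ∈ W ×ˢ S, {ω : V × V → Bool | q (ω e) (ω e.swap)} := by
    ext ω
    simp only [Set.mem_ofPred_eq, Set.mem_iInter, Finset.mem_product, Prod.forall,
      Prod.swap_prod_mk]
    exact ⟨fun h w s hws => h w hws.1 s hws.2, fun h w hw s hs => h w s ⟨hw, hs⟩⟩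
  rw [h, pr_biInter _ _ (fun e => {e, e.swap})]
  · rw [Finset.prod_congr rfl (g := fun _ => r), Finset.prod_const, Finset.card_product]
    rintro ⟨w, s⟩ he
    rw [Finset.mem_product] at he
    refine hq _ _ fun h => ?_
    have : w = s := congrArg Prod.fst h
    exact Finset.disjoint_left.1 hd he.1 (this ▸ he.2)
  · intro e _ x y hxy
    simp [hxy e (by simp), hxy e.swap (by simp)]
  · rintro ⟨w, s⟩ he ⟨w', s'⟩ he' hne
    simp only [Finset.coe_product, Set.mem_prod, Finset.mem_coe] at he he'
    have h1 : w ≠ s' := fun h => Finset.disjoint_left.1 hd he.1 (h ▸ he'.2)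
    have h2 : w' ≠ s := fun h => Finset.disjoint_left.1 hd he'.1 (h ▸ he.2)
    have h3 : ¬ (w = w' ∧ s = s') := fun h => hne (by rw [h.1, h.2])
    rw [Function.onFun, Set.disjoint_left]
    simp only [Prod.swap_prod_mk, Set.mem_insert_iff, Set.mem_singleton_iff]
    rintro e (rfl | rfl) h
    · rcases h with h | h <;> simp only [Prod.mk.injEq] at h
      · exact h3 h
      · exact h1 h.1
    · rcases h with h | h <;> simp only [Prod.mk.injEq] at h
      · exact h2 h.1.symm
      · exact h3 h.symm

/-- A union bound over at most `4^|V|` choices of `(S, W)`, each of which spans at least `kn/200`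
independent pairs. -/
lemma pr_exists_homogeneous_le (q : Bool → Bool → Prop) (n k : ℕ)
    (hq : ∀ a b : V × V, a ≠ b → pr {ω : V × V → Bool | q (ω a) (ω b)} = 3 / 4) :
    pr {ω : V × V → Bool | ∃ S W : Finset V, Disjoint W S ∧ k ≤ 2 * S.card ∧ n ≤ 100 * W.card ∧
      ∀ w ∈ W, ∀ s ∈ S, q (ω (w, s)) (ω (s, w))} ≤
      4 ^ Fintype.card V * (3 / 4) ^ (k * n / 200) := by
  let J : Finset (Finset V × Finset V) := Finset.univ.filter fun e =>
    Disjoint e.2 e.1 ∧ k ≤ 2 * e.1.card ∧ n ≤ 100 * e.2.card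
  refine (pr_mono (B := ⋃ e ∈ J, {ω : V × V → Bool |
    ∀ w ∈ e.2, ∀ s ∈ e.1, q (ω (w, s)) (ω (s, w))}) ?_).trans
    ((pr_iUnion_le J _).trans ?_)
  · rintro ω ⟨S, W, h1, h2, h3, h4⟩
    simp only [Set.mem_iUnion]
    exact ⟨(S, W), by simp [J, h1, h2, h3], h4⟩
  · refine (Finset.sum_le_card_nsmul J _ ((3 / 4 : ℝ) ^ (k * n / 200)) fun e he => ?_).trans ?_
    · simp only [J, Finset.mem_filter] at he
      rw [pr_forall_pairs he.2.1 q hq]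
      refine pow_le_pow_of_le_one (by norm_num) (by norm_num) ?_
      have := Nat.mul_le_mul he.2.2.1 he.2.2.2
      have h5 : k * n ≤ 200 * (e.2.card * e.1.card) := this.trans (by ring_nf; rfl)
      omega
    · rw [nsmul_eq_mul]
      gcongr
      have h : J.card ≤ 4 ^ Fintype.card V := by
        refine (Finset.card_filter_le _ _).trans ?_
        rw [Finset.card_univ, Fintype.card_prod, Fintype.card_finset, ← mul_pow]
        norm_num
      exact_mod_cast h

lemma pr_double_dev_le {U : Finset V} {x : V} (hx : x ∉ U) {k : ℕ} (hk : 0 < k) :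
    pr {ω : V × V → Bool | ¬ |({u ∈ (U : Set V) | Double (ofBits ω) u x}.ncard : ℝ) -
      (U.card : ℝ) / 4| ≤ (U.card : ℝ) / (16 * k)} ≤
      2 * Real.exp (-(U.card : ℝ) / (1024 * k ^ 2)) := by
  have hkR : (1 : ℝ) ≤ k := by exact_mod_cast hk
  -- This `t` minimises the Chernoff exponent `-t/(16k) + t²` per node of `U`.
  set t : ℝ := 1 / (32 * k) with ht
  have ht0 : 0 < t := by positivity
  have ht1 : t ≤ 1 := by
    rw [ht, div_le_one (by positivity)]; linarith
  set e : ℝ := t * ((U.card : ℝ) / (16 * k)) with he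
  have hne : ∀ u ∈ U, ((u, x) : V × V) ≠ (x, u) := fun u hu h => by
    have hux : u = x := congrArg Prod.fst h
    exact hx (hux ▸ hu)
  have hd : (U : Set V).PairwiseDisjoint fun u => ({(u, x), (x, u)} : Set (V × V)) := by
    intro u hu v hv huv
    rw [Function.onFun, Set.disjoint_left]
    simp only [Set.mem_insert_iff, Set.mem_singleton_iff]
    have hux : u ≠ x := fun h => hx (h ▸ hu)
    rintro _ (rfl | rfl) h
    · rcases h with h | h <;> simp only [Prod.mk.injEq] at h
      · exact huv h.1
      · exact hux h.1
    · rcases h with h | h <;> simp only [Prod.mk.injEq] at h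
      · exact hux h.2
      · exact huv h.2
  have hval : -e + t ^ 2 * (U.card : ℝ) = -(U.card : ℝ) / (1024 * k ^ 2) := by
    rw [he, ht]; field_simp; ring
  have h1 := pr_double_count_le U (fun u => (u, x)) (fun u => (x, u)) hne hd t
    (by rw [abs_of_pos ht0]; exact ht1) e
  have h2 := pr_double_count_le U (fun u => (u, x)) (fun u => (x, u)) hne hd (-t)
    (by rw [abs_neg, abs_of_pos ht0]; exact ht1) e
  rw [neg_sq] at h2
  rw [hval] at h1 h2
  rw [two_mul]
  refine (pr_mono ?_).trans ((pr_union_le _ _).trans (add_le_add h1 h2))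
  intro ω hω
  have hc : ({u ∈ (U : Set V) | Double (ofBits ω) u x}.ncard : ℝ) =
      ({u ∈ U | ω (u, x) ∧ ω (x, u)}.card : ℝ) := by
    rw [← Set.ncard_coe_finset]
    congr 2
    ext u
    simp [Double, ofBits]
  simp only [Set.mem_ofPred_eq, not_le, hc] at hω
  rcases lt_abs.1 hω with h | h
  · left
    exact mul_le_mul_of_nonneg_left h.le ht0.le
  · right
    simp only [Set.mem_ofPred_eq]
    rw [he]
    nlinarith

/-- Random digraphs fail to be quasirandom with a tiny probability. -/
theorem pr_not_quasirandom_le (U : Finset V) {k : ℕ} (hk : 0 < k) :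
    pr {ω : V × V → Bool | ¬ Quasirandom (ofBits ω) (U : Set V) U.card k} ≤
      Fintype.card V * (2 * Real.exp (-(U.card : ℝ) / (1024 * k ^ 2))) +
        2 * (4 ^ Fintype.card V * (3 / 4) ^ (k * U.card / 200)) := by
  classical
  let A : V → Set (V × V → Bool) := fun x =>
    {ω | ¬ |({u ∈ (U : Set V) | Double (ofBits ω) u x}.ncard : ℝ) -
      (U.card : ℝ) / 4| ≤ (U.card : ℝ) / (16 * k)}
  let B : (Bool → Bool → Prop) → Set (V × V → Bool) := fun q =>
    {ω | ∃ S W : Finset V, Disjoint W S ∧ k ≤ 2 * S.card ∧ U.card ≤ 100 * W.card ∧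
      ∀ w ∈ W, ∀ s ∈ S, q (ω (w, s)) (ω (s, w))}
  -- `q₁` and `q₂` describe violations of `conn` and `single`. Each excludes exactly one of the four
  -- states of a node pair, whence the base `3/4`.
  let q₁ : Bool → Bool → Prop := fun a b => a = true ∨ b = true
  let q₂ : Bool → Bool → Prop := fun a b => ¬ (a = true ∧ ¬ b = true)
  have hsub : {ω : V × V → Bool | ¬ Quasirandom (ofBits ω) (U : Set V) U.card k} ⊆
      (⋃ x ∈ Uᶜ, A x) ∪ (B q₁ ∪ B q₂) := by
    intro ω hω
    by_contra hcon
    simp only [Set.mem_union, not_or, Set.mem_iUnion, not_exists] at hcon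
    obtain ⟨h1, h2, h3⟩ := hcon
    refine hω ⟨fun x hx => ?_, fun S hS W hW hk hn => ?_, fun S hS W hW hk hn => ?_⟩
    · by_contra h
      exact h1 x (by simpa using hx) h
    · by_contra! h
      refine h2 ⟨S.toFinset, W.toFinset, by simpa using hW, ?_, ?_, ?_⟩
      · rwa [← Set.ncard_eq_toFinset_card']
      · rwa [← Set.ncard_eq_toFinset_card']
      · intro w hw s hs
        exact h w (by simpa using hw) s (by simpa using hs)
    · by_contra! h
      refine h3 ⟨S.toFinset, W.toFinset, by simpa using hW, ?_, ?_, ?_⟩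
      · rwa [← Set.ncard_eq_toFinset_card']
      · rwa [← Set.ncard_eq_toFinset_card']
      · rintro w hw s hs ⟨h4, h5⟩
        exact h5 (h w (by simpa using hw) s (by simpa using hs) h4)
  refine (pr_mono hsub).trans ((pr_union_le _ _).trans (add_le_add ?_ ?_))
  · refine (pr_iUnion_le _ _).trans ((Finset.sum_le_card_nsmul _ _ _ fun x hx =>
      pr_double_dev_le (by simpa using hx) hk).trans ?_)
    rw [nsmul_eq_mul]
    gcongr
    exact Finset.card_le_univ _
  · rw [two_mul]
    refine (pr_union_le _ _).trans (add_le_add ?_ ?_) <;>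
    · refine pr_exists_homogeneous_le _ _ _ fun a b hab => ?_
      rw [pr_two_bits hab]
      norm_num [q₁, q₂]

end

/-! ### Tournaments as sequences -/

/-- On a tournament adjacency is a linear order, the loops giving reflexivity; the enumeration is
its order isomorphism with `Fin k`. -/
lemma IsTournament.exists_enum {V : Type*} {G : Digraph V} [Finite V] {S : Set V}
    (hS : IsTournament G S) {k : ℕ} (hk : S.ncard = k) :
    ∃ f : Fin k → V, Function.Injective f ∧ Set.range f = S ∧
      ∀ i j, i < j → G.Adj (f i) (f j) ∧ ¬ G.Adj (f j) (f i) := by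
  classical
  let _ : LinearOrder S :=
    { le := fun x y => G.Adj x y
      le_refl := fun x => hS.1 x x.2
      le_trans := fun x y z h1 h2 => hS.2.2 x x.2 y y.2 z z.2 h1 h2
      le_antisymm := fun x y h1 h2 => by
        by_contra h
        exact (hS.2.1 x x.2 y y.2 (fun h' => h (Subtype.ext h'))).1 h1 h2
      le_total := fun x y => by
        by_cases h : (x : V) = y
        · left; rw [← h]; exact hS.1 x x.2
        · have := hS.2.1 x x.2 y y.2 h
          tauto
      toDecidableLE := Classical.decRel _ }
  let _ : Fintype S := Fintype.ofFinite S
  let e := Fintype.orderIsoFinOfCardEq S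
    (show Fintype.card S = k by rw [← hk, ← Nat.card_coe_set_eq, Nat.card_eq_fintype_card])
  refine ⟨fun i => (e i : V), fun i j h => e.injective (Subtype.ext h), ?_, fun i j h => ?_⟩
  · ext x
    constructor
    · rintro ⟨i, rfl⟩; exact (e i).2
    · intro hx
      exact ⟨e.symm ⟨x, hx⟩, by simp⟩
  · have hlt : e i < e j := e.strictMono h
    exact ⟨hlt.le, fun h' => absurd h' (not_le_of_gt hlt)⟩

/-! ### Planting a tournament -/

/-- A tournament of `k` nodes, a set `U` of un-looped nodes, and sets `A` of un-looped and `B` of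
looped nodes that are to be joined to the tournament by double edges. -/
structure Planting (V : Type*) (k : ℕ) where
  node : Fin k ↪ V
  U : Finset V
  A : Finset V
  B : Finset V
  A_subset : A ⊆ U
  B_disjoint : Disjoint B U
  node_notMem_U : ∀ i, node i ∉ U
  node_notMem_B : ∀ i, node i ∉ B

namespace Planting

variable {V : Type*} [Fintype V] [DecidableEq V] {k : ℕ} (Q : Planting V k)

/-- The nodes of the tournament. -/
def T : Finset V := Finset.univ.map Q.node

/-- The nodes with a prescribed connection to the tournament. -/
def D : Finset V := Q.A ∪ Q.B

/-- The nodes whose connection to the tournament is not prescribed. -/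
def rest : Finset V := (Q.T ∪ Q.D)ᶜ

/-- The node pairs with a prescribed bit. -/
def fixedPairs : Finset (V × V) := Finset.univ.filter fun e =>
  e.1 = e.2 ∨ (e.1 ∈ Q.T ∧ e.2 ∈ Q.T) ∨ (e.1 ∈ Q.D ∧ e.2 ∈ Q.T) ∨ (e.1 ∈ Q.T ∧ e.2 ∈ Q.D)

open Classical in
/-- The prescribed bits. -/
noncomputable def fixedBit (e : V × V) : Bool :=
  if e.1 = e.2 then decide (e.1 ∉ Q.U)
  else if e.1 ∈ Q.T ∧ e.2 ∈ Q.T then decide (∃ i j, Q.node i = e.1 ∧ Q.node j = e.2 ∧ i < j)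
  else true

/-- The digraphs with the prescribed bits. -/
def fixed : Set (V × V → Bool) := {ω | ∀ e ∈ Q.fixedPairs, ω e = Q.fixedBit e}

/-- `y` is not connected to some node of the tournament, and has a single edge into it. -/
def loose (y : V) : Set (V × V → Bool) :=
  {ω | (∃ t ∈ Q.T, ¬ (ω (y, t) = true ∨ ω (t, y) = true)) ∧
    ∃ t ∈ Q.T, ω (y, t) = true ∧ ¬ ω (t, y) = true}

/-- The pairs between `y` and the tournament. -/
def pairsAt (y : V) : Set (V × V) := {e | (e.1 = y ∧ e.2 ∈ Q.T) ∨ (e.1 ∈ Q.T ∧ e.2 = y)}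

/-- The digraphs with the planted structure. -/
def planted : Set (V × V → Bool) := Q.fixed ∩ ⋂ y ∈ Q.rest, Q.loose y

lemma mem_T {x : V} : x ∈ Q.T ↔ ∃ i, Q.node i = x := by simp [T]

lemma node_mem_T (i : Fin k) : Q.node i ∈ Q.T := Q.mem_T.2 ⟨i, rfl⟩

lemma card_T : Q.T.card = k := by simp [T]

lemma notMem_U_of_mem_T {x : V} (h : x ∈ Q.T) : x ∉ Q.U := by
  obtain ⟨i, rfl⟩ := Q.mem_T.1 h
  exact Q.node_notMem_U i

lemma notMem_D_of_mem_T {x : V} (h : x ∈ Q.T) : x ∉ Q.D := by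
  obtain ⟨i, rfl⟩ := Q.mem_T.1 h
  simp only [D, Finset.mem_union, not_or]
  exact ⟨fun h => Q.node_notMem_U i (Q.A_subset h), Q.node_notMem_B i⟩

lemma mem_rest {x : V} : x ∈ Q.rest ↔ x ∉ Q.T ∧ x ∉ Q.D := by
  simp [rest]

lemma card_fixedPairs_le :
    Q.fixedPairs.card ≤ Fintype.card V + k ^ 2 + 2 * k * Q.D.card := by
  have h : Q.fixedPairs ⊆ (Finset.univ.image fun x : V => (x, x)) ∪ (Q.T ×ˢ Q.T) ∪
      ((Q.D ×ˢ Q.T) ∪ (Q.T ×ˢ Q.D)) := by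
    rintro ⟨x, y⟩ he
    simp only [fixedPairs, Finset.mem_filter, Finset.mem_univ, true_and] at he
    simp only [Finset.mem_union, Finset.mem_product, Finset.mem_image, Finset.mem_univ, true_and,
      Prod.mk.injEq]
    rcases he with rfl | h | h | h
    · exact Or.inl (Or.inl ⟨x, rfl, rfl⟩)
    · exact Or.inl (Or.inr h)
    · exact Or.inr (Or.inl h)
    · exact Or.inr (Or.inr h)
  have h1 := Finset.card_le_card h
  have h2 := Finset.card_union_le ((Finset.univ.image fun x : V => (x, x)) ∪ (Q.T ×ˢ Q.T))
    ((Q.D ×ˢ Q.T) ∪ (Q.T ×ˢ Q.D))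
  have h3 := Finset.card_union_le (Finset.univ.image fun x : V => (x, x)) (Q.T ×ˢ Q.T)
  have h4 := Finset.card_union_le (Q.D ×ˢ Q.T) (Q.T ×ˢ Q.D)
  have h5 : (Finset.univ.image fun x : V => (x, x)).card ≤ Fintype.card V := Finset.card_image_le
  simp only [Finset.card_product, card_T] at h2 h3 h4
  nlinarith

lemma dependsOn_fixed : DependsOn (· ∈ Q.fixed) (Q.fixedPairs : Set (V × V)) := by
  intro x y h
  simp only [fixed, Set.mem_ofPred_eq, eq_iff_iff]
  exact forall₂_congr fun e he => by rw [h e he]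

lemma dependsOn_loose (y : V) : DependsOn (· ∈ Q.loose y) (Q.pairsAt y) := by
  intro ω ω' h
  have h1 : ∀ t ∈ Q.T, ω (y, t) = ω' (y, t) := fun t ht => h _ (Or.inl ⟨rfl, ht⟩)
  have h2 : ∀ t ∈ Q.T, ω (t, y) = ω' (t, y) := fun t ht => h _ (Or.inr ⟨ht, rfl⟩)
  simp only [loose, Set.mem_ofPred_eq, eq_iff_iff]
  refine and_congr (exists_congr fun t => and_congr_right fun ht => ?_)
    (exists_congr fun t => and_congr_right fun ht => ?_) <;> rw [h1 t ht, h2 t ht]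

lemma dependsOn_iInter_loose (Y : Finset V) :
    DependsOn (· ∈ ⋂ y ∈ Y, Q.loose y) (⋃ y ∈ Y, Q.pairsAt y) := by
  intro ω ω' h
  simp only [Set.mem_iInter, eq_iff_iff]
  refine forall₂_congr fun y hy => ?_
  have hd : ω ∈ Q.loose y ↔ ω' ∈ Q.loose y := iff_of_eq
    (Q.dependsOn_loose y fun e he => h e (Set.mem_iUnion₂.2 ⟨y, hy, he⟩))
  exact hd

lemma disjoint_pairsAt {x y : V} (hx : x ∉ Q.T) (hxy : x ≠ y) :
    Disjoint (Q.pairsAt x) (Q.pairsAt y) := by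
  rw [Set.disjoint_left]
  rintro ⟨a, b⟩ (⟨rfl, h1⟩ | ⟨h1, rfl⟩) (⟨h2, h3⟩ | ⟨h2, h3⟩)
  · exact hxy h2
  · exact hx h2
  · exact hx h3
  · exact hxy h3

lemma disjoint_fixedPairs {Y : Finset V} (hY : Y ⊆ Q.rest) :
    Disjoint (Q.fixedPairs : Set (V × V)) (⋃ y ∈ Y, Q.pairsAt y) := by
  rw [Set.disjoint_left]
  rintro ⟨a, b⟩ h1 h2
  simp only [Set.mem_iUnion] at h2
  obtain ⟨y, hy, h2⟩ := h2
  have hyR := Q.mem_rest.1 (hY hy)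
  simp only [fixedPairs, Finset.coe_filter, Finset.mem_univ, true_and, Set.mem_ofPred_eq] at h1
  rcases h2 with ⟨rfl, h2⟩ | ⟨h2, rfl⟩
  · rcases h1 with rfl | h | h | h
    · exact hyR.1 h2
    · exact hyR.1 h.1
    · exact hyR.2 h.1
    · exact hyR.1 h.1
  · rcases h1 with rfl | h | h | h
    · exact hyR.1 h2
    · exact hyR.1 h.2
    · exact hyR.1 h.2
    · exact hyR.2 h.2

/-- Either requirement of looseness fails only if all `k` pairs from `y` to the tournament avoid one
of four states. -/
lemma pr_loose_compl_le {y : V} (hy : y ∉ Q.T) : pr (Q.loose y)ᶜ ≤ 2 * (3 / 4) ^ k := by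
  classical
  let q₁ : Bool → Bool → Prop := fun a b => a = true ∨ b = true
  let q₂ : Bool → Bool → Prop := fun a b => ¬ (a = true ∧ ¬ b = true)
  have hsub : (Q.loose y)ᶜ ⊆
      {ω | ∀ w ∈ ({y} : Finset V), ∀ s ∈ Q.T, q₁ (ω (w, s)) (ω (s, w))} ∪
      {ω | ∀ w ∈ ({y} : Finset V), ∀ s ∈ Q.T, q₂ (ω (w, s)) (ω (s, w))} := by
    intro ω hω
    by_contra hcon
    simp only [Set.mem_union, not_or, Set.mem_ofPred_eq, not_forall, Finset.mem_singleton] at hcon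
    obtain ⟨⟨_, rfl, s, hs, h1⟩, ⟨_, rfl, s', hs', h2⟩⟩ := hcon
    exact hω ⟨⟨s, hs, h1⟩, ⟨s', hs', not_not.1 h2⟩⟩
  refine (pr_mono hsub).trans ((pr_union_le _ _).trans ?_)
  have hd : Disjoint ({y} : Finset V) Q.T := by simpa using hy
  rw [pr_forall_pairs hd q₁ (r := 3 / 4), pr_forall_pairs hd q₂ (r := 3 / 4)]
  · simp [card_T]; linarith
  all_goals
    intro a b hab
    rw [pr_two_bits hab]
    norm_num [q₁, q₂]

lemma pr_iInter_loose {Y : Finset V} (hY : Disjoint Y Q.T) :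
    pr (⋂ y ∈ Y, Q.loose y) = ∏ y ∈ Y, pr (Q.loose y) :=
  pr_biInter Y _ Q.pairsAt (fun y _ => Q.dependsOn_loose y) fun _ hx _ _ hxy =>
    Q.disjoint_pairsAt (Finset.disjoint_left.1 hY hx) hxy

lemma rest_disjoint : Disjoint Q.rest Q.T :=
  Finset.disjoint_left.2 fun _ h => (Q.mem_rest.1 h).1

lemma pr_planted : pr Q.planted = pr Q.fixed * pr (⋂ y ∈ Q.rest, Q.loose y) :=
  pr_inter Q.dependsOn_fixed (Q.dependsOn_iInter_loose _) (Q.disjoint_fixedPairs subset_rfl)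

/-- The prescribed bits cost a factor `1/2` each; looseness of the remaining nodes is independent of
them and across nodes. -/
lemma le_pr_planted (hk : 2 * (3 / 4 : ℝ) ^ k ≤ 1) :
    (1 / 2 : ℝ) ^ (Fintype.card V + k ^ 2 + 2 * k * Q.D.card) *
      (1 - 2 * (3 / 4) ^ k) ^ Fintype.card V ≤ pr Q.planted := by
  rw [pr_planted]
  have h0 : (0 : ℝ) ≤ 1 - 2 * (3 / 4) ^ k := by linarith
  have h1 : (1 / 2 : ℝ) ^ (Fintype.card V + k ^ 2 + 2 * k * Q.D.card) ≤ pr Q.fixed := by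
    have h := pr_bits Q.fixedPairs id Function.injective_id.injOn Q.fixedBit
    have h' : pr Q.fixed = (1 / 2) ^ Q.fixedPairs.card := h
    rw [h']
    exact pow_le_pow_of_le_one (by norm_num) (by norm_num) Q.card_fixedPairs_le
  have h2 : (1 - 2 * (3 / 4 : ℝ) ^ k) ^ Fintype.card V ≤ pr (⋂ y ∈ Q.rest, Q.loose y) := by
    rw [Q.pr_iInter_loose Q.rest_disjoint]
    calc (1 - 2 * (3 / 4 : ℝ) ^ k) ^ Fintype.card V
        ≤ (1 - 2 * (3 / 4 : ℝ) ^ k) ^ Q.rest.card := by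
          refine pow_le_pow_of_le_one h0 ?_ (Finset.card_le_univ _)
          have : (0 : ℝ) ≤ (3 / 4) ^ k := by positivity
          linarith
      _ = ∏ _y ∈ Q.rest, (1 - 2 * (3 / 4 : ℝ) ^ k) := by rw [Finset.prod_const]
      _ ≤ _ := by
          refine Finset.prod_le_prod (fun _ _ => h0) fun y hy => ?_
          have := Q.pr_loose_compl_le (Q.mem_rest.1 hy).1
          rw [pr_compl] at this
          linarith
  exact mul_le_mul h1 h2 (by positivity) (pr_nonneg _)

end Planting

namespace Planting

variable {V : Type*} [Fintype V] [DecidableEq V] {k : ℕ} (Q : Planting V k)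

/-! ### Other tournaments are rare -/

/-- The sequences of `k` looped nodes, in the tournament at the positions in `P`, that might
form a tournament in a digraph with the planted structure. -/
structure Candidate (P : Finset (Fin k)) (f : Fin k → V) : Prop where
  inj : Function.Injective f
  notMem_U : ∀ i, f i ∉ Q.U
  mem_T : ∀ i, f i ∈ Q.T ↔ i ∈ P
  mem_rest : P.Nonempty → ∀ i ∉ P, f i ∈ Q.rest
  mono : ∀ i ∈ P, ∀ j ∈ P, i < j → ∀ a b, Q.node a = f i → Q.node b = f j → a < b

/-- The position pairs that are not both in `P`. -/
def freshPairs (P : Finset (Fin k)) : Finset (Fin k × Fin k) :=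
  Finset.univ.offDiag \ P.offDiag

/-- `f` is a tournament outside the planted one. -/
def chain (P : Finset (Fin k)) (f : Fin k → V) : Set (V × V → Bool) :=
  {ω | ∀ e ∈ freshPairs P, ω (f e.1, f e.2) = decide (e.1 < e.2)}

lemma mem_freshPairs {P : Finset (Fin k)} {e : Fin k × Fin k} :
    e ∈ freshPairs P ↔ e.1 ≠ e.2 ∧ ¬ (e.1 ∈ P ∧ e.2 ∈ P) := by
  simp only [freshPairs, Finset.mem_sdiff, Finset.mem_offDiag, Finset.mem_univ, true_and]
  tauto

/-- With `m = |P|` this is `k(k-1) - m(m-1)`, arranged to avoid subtraction. -/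
lemma card_freshPairs {P : Finset (Fin k)} {r : ℕ} (hr : P.card + r = k) :
    (freshPairs P).card + r = r * (2 * P.card + r) := by
  have h := Finset.card_sdiff_add_card_eq_card
    (Finset.offDiag_mono (Finset.subset_univ P))
  rw [Finset.offDiag_card, Finset.offDiag_card, Finset.card_univ, Fintype.card_fin] at h
  change (freshPairs P).card + _ = _ at h
  have h1 : P.card ≤ P.card * P.card := Nat.le_mul_self _
  have h2 : k ≤ k * k := Nat.le_mul_self _
  zify [h1, h2] at h ⊢
  have h3 : (k : ℤ) = P.card + r := by exact_mod_cast hr.symm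
  rw [h3] at h
  linarith

variable {Q}

lemma Candidate.pr_chain {P : Finset (Fin k)} {f : Fin k → V} (hf : Q.Candidate P f) :
    pr (chain P f) = (1 / 2) ^ (freshPairs P).card := by
  refine pr_bits (freshPairs P) (fun e => (f e.1, f e.2)) ?_ fun e => decide (e.1 < e.2)
  rintro ⟨a, b⟩ - ⟨c, d⟩ - h
  simp only [Prod.mk.injEq] at h
  rw [hf.inj h.1, hf.inj h.2]

lemma dependsOn_chain (P : Finset (Fin k)) (f : Fin k → V) :
    DependsOn (· ∈ chain P f) ((fun e : Fin k × Fin k => (f e.1, f e.2)) '' freshPairs P) := by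
  intro ω ω' h
  simp only [chain, Set.mem_ofPred_eq, eq_iff_iff]
  exact forall₂_congr fun e he => by rw [h _ ⟨e, he, rfl⟩]

/-- A fresh pair within `T` would have both positions in `P`, and one between `D` and `T` is
excluded by `mem_rest`. So planting does not bias the fresh edges. -/
lemma Candidate.disjoint_fixedPairs {P : Finset (Fin k)} {f : Fin k → V}
    (hf : Q.Candidate P f) : Disjoint (Q.fixedPairs : Set (V × V))
      ((fun e : Fin k × Fin k => (f e.1, f e.2)) '' freshPairs P) := by
  rw [Set.disjoint_left]
  rintro _ h1 ⟨⟨i, j⟩, h2, rfl⟩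
  have h3 := mem_freshPairs.1 h2
  simp only [fixedPairs, Finset.coe_filter, Finset.mem_univ, true_and, Set.mem_ofPred_eq] at h1
  rcases h1 with h | h | h | h
  · exact h3.1 (hf.inj h)
  · exact h3.2 ⟨(hf.mem_T i).1 h.1, (hf.mem_T j).1 h.2⟩
  · have hj := (hf.mem_T j).1 h.2
    exact (Q.mem_rest.1 (hf.mem_rest ⟨j, hj⟩ i fun hi => h3.2 ⟨hi, hj⟩)).2 h.1
  · have hi := (hf.mem_T i).1 h.1
    exact (Q.mem_rest.1 (hf.mem_rest ⟨i, hi⟩ j fun hj => h3.2 ⟨hi, hj⟩)).2 h.2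

/-- Only the looseness of nodes on `f` can be correlated with the chain event. These are at most `k`
nodes, jointly loose with probability at least `1/2`; dropping their conditions costs a factor of at
most `2` and makes the rest independent of the chain. -/
lemma Candidate.pr_inter_le {P : Finset (Fin k)} {f : Fin k → V} (hf : Q.Candidate P f)
    (hk : (k : ℝ) * (2 * (3 / 4) ^ k) ≤ 1 / 2) :
    pr (Q.planted ∩ chain P f) ≤ 2 * pr Q.planted * (1 / 2) ^ (freshPairs P).card := by
  classical
  let X : Finset V := Q.rest ∩ Finset.univ.image f
  let Y : Finset V := Q.rest \ X
  have hYR : Y ⊆ Q.rest := Finset.sdiff_subset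
  have hXR : X ⊆ Q.rest := Finset.inter_subset_left
  have hX : 1 / 2 ≤ pr (⋂ y ∈ X, Q.loose y) := by
    have h1 : (⋂ y ∈ X, Q.loose y)ᶜ = ⋃ y ∈ X, (Q.loose y)ᶜ := by simp
    have h2 : pr (⋂ y ∈ X, Q.loose y)ᶜ ≤ k * (2 * (3 / 4) ^ k) := by
      rw [h1]
      refine (pr_iUnion_le _ _).trans ((Finset.sum_le_card_nsmul X _ _ fun y hy =>
        Q.pr_loose_compl_le (Q.mem_rest.1 (hXR hy)).1).trans ?_)
      rw [nsmul_eq_mul]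
      gcongr
      refine (Finset.card_le_card Finset.inter_subset_right).trans
        (Finset.card_image_le.trans ?_)
      simp
    rw [pr_compl] at h2
    linarith
  have hsplit : pr (⋂ y ∈ Q.rest, Q.loose y) =
      pr (⋂ y ∈ Y, Q.loose y) * pr (⋂ y ∈ X, Q.loose y) := by
    rw [Q.pr_iInter_loose Q.rest_disjoint,
      Q.pr_iInter_loose (Finset.disjoint_of_subset_left hYR Q.rest_disjoint),
      Q.pr_iInter_loose (Finset.disjoint_of_subset_left hXR Q.rest_disjoint),
      Finset.prod_sdiff hXR]
  have hY : pr (⋂ y ∈ Y, Q.loose y) ≤ 2 * pr (⋂ y ∈ Q.rest, Q.loose y) := by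
    rw [hsplit]
    nlinarith [pr_nonneg (⋂ y ∈ Y, Q.loose y)]
  have hdisj : Disjoint ((Q.fixedPairs : Set (V × V)) ∪ ⋃ y ∈ Y, Q.pairsAt y)
      ((fun e : Fin k × Fin k => (f e.1, f e.2)) '' freshPairs P) := by
    rw [Set.disjoint_union_left]
    refine ⟨hf.disjoint_fixedPairs, ?_⟩
    rw [Set.disjoint_left]
    rintro _ h1 ⟨⟨i, j⟩, -, rfl⟩
    simp only [Set.mem_iUnion] at h1
    obtain ⟨y, hy, h1⟩ := h1
    simp only [Y, X, Finset.mem_sdiff, Finset.mem_inter, not_and] at hy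
    refine hy.2 hy.1 ?_
    rcases h1 with ⟨rfl, _⟩ | ⟨_, rfl⟩ <;> simp
  have hdep : DependsOn (· ∈ Q.fixed ∩ ⋂ y ∈ Y, Q.loose y)
      ((Q.fixedPairs : Set (V × V)) ∪ ⋃ y ∈ Y, Q.pairsAt y) := by
    intro ω ω' h
    have h1 : ω ∈ Q.fixed ↔ ω' ∈ Q.fixed :=
      iff_of_eq (Q.dependsOn_fixed fun e he => h e (Or.inl he))
    have h2 : ω ∈ (⋂ y ∈ Y, Q.loose y) ↔ ω' ∈ (⋂ y ∈ Y, Q.loose y) :=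
      iff_of_eq (Q.dependsOn_iInter_loose Y fun e he => h e (Or.inr he))
    simp only [Set.mem_inter_iff, h1, h2]
  calc pr (Q.planted ∩ chain P f) ≤ pr ((Q.fixed ∩ ⋂ y ∈ Y, Q.loose y) ∩ chain P f) := by
        refine pr_mono (Set.inter_subset_inter_left _ (Set.inter_subset_inter_right _ ?_))
        exact Set.biInter_subset_biInter_left hYR
    _ = pr Q.fixed * pr (⋂ y ∈ Y, Q.loose y) * (1 / 2) ^ (freshPairs P).card := by
        rw [pr_inter hdep (dependsOn_chain P f) hdisj, hf.pr_chain,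
          pr_inter Q.dependsOn_fixed (Q.dependsOn_iInter_loose _) (Q.disjoint_fixedPairs hYR)]
    _ ≤ _ := by
        rw [pr_planted]
        have := mul_le_mul_of_nonneg_left hY (pr_nonneg Q.fixed)
        exact mul_le_mul_of_nonneg_right (by linarith) (by positivity)

variable (Q)

open Classical in
/-- The candidates with tournament positions `P`. -/
noncomputable def candidates (P : Finset (Fin k)) : Finset (Fin k → V) :=
  Finset.univ.filter (Q.Candidate P)

/-- The part of `f` inside the planted tournament is increasing, so its image determines it; this
gives a binomial coefficient in place of `k^|P|`. The other values are looped nodes outside `T`. -/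
lemma card_candidates_le (P : Finset (Fin k)) {n : ℕ} (hn : (Q.U ∪ Q.T)ᶜ.card ≤ n) :
    (Q.candidates P).card ≤ k.choose P.card * n ^ (k - P.card) := by
  classical
  let img : (Fin k → V) → Finset (Fin k) := fun f =>
    Finset.univ.filter fun a => ∃ i ∈ P, f i = Q.node a
  let φ : (Fin k → V) → Finset (Fin k) × ({i // i ∉ P} → V) := fun f => (img f, fun i => f i)
  have hg : ∀ f, Q.Candidate P f → ∃ g : P → Fin k, StrictMono g ∧
      (∀ i : P, Q.node (g i) = f i) ∧ Set.range g = (img f : Set (Fin k)) := by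
    intro f hf
    have h1 : ∀ i : P, ∃ a, Q.node a = f i := fun i => Q.mem_T.1 ((hf.mem_T i).2 i.2)
    choose g hg using h1
    refine ⟨g, fun i j hij => hf.mono i i.2 j j.2 hij _ _ (hg i) (hg j), hg, ?_⟩
    ext a
    simp only [Set.mem_range, img, Finset.coe_filter, Finset.mem_univ, true_and,
      Set.mem_ofPred_eq]
    constructor
    · rintro ⟨i, rfl⟩
      exact ⟨i, i.2, (hg i).symm⟩
    · rintro ⟨i, hi, h⟩
      exact ⟨⟨i, hi⟩, Q.node.injective ((hg ⟨i, hi⟩).trans h)⟩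
  have hcard : (Finset.powersetCard P.card (Finset.univ : Finset (Fin k)) ×ˢ
      Fintype.piFinset fun _ : {i // i ∉ P} => (Q.U ∪ Q.T)ᶜ).card ≤
      k.choose P.card * n ^ (k - P.card) := by
    rw [Finset.card_product, Finset.card_powersetCard, Finset.card_univ, Fintype.card_fin,
      Fintype.card_piFinset, Finset.prod_const, Finset.card_univ, Fintype.card_subtype_compl, Fintype.card_fin,
      Fintype.card_coe]
    gcongr
  refine le_trans (Finset.card_le_card_of_injOn φ ?_ ?_) hcard
  · intro f hf
    have hf : Q.Candidate P f := by simpa [candidates] using hf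
    obtain ⟨g, hg1, hg2, hg3⟩ := hg f hf
    simp only [φ, Finset.coe_product, Set.mem_prod, Finset.mem_coe, Finset.mem_powersetCard,
      Finset.subset_univ, true_and, Fintype.mem_piFinset, Finset.mem_compl, Finset.mem_union,
      not_or]
    refine ⟨?_, fun i => ⟨hf.notMem_U i, fun h => i.2 ((hf.mem_T i).1 h)⟩⟩
    rw [← Set.ncard_coe_finset, ← hg3, ← Set.image_univ,
      Set.ncard_image_of_injective _ hg1.injective, Set.ncard_univ]
    simp
  · intro f hf f' hf' h
    have hf : Q.Candidate P f := by simpa [candidates] using hf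
    have hf' : Q.Candidate P f' := by simpa [candidates] using hf'
    obtain ⟨g, hg1, hg2, hg3⟩ := hg f hf
    obtain ⟨g', hg1', hg2', hg3'⟩ := hg f' hf'
    simp only [φ, Prod.mk.injEq] at h
    have hgg : g = g' := (StrictMono.range_inj hg1 hg1').1 (by rw [hg3, hg3', h.1])
    ext i
    by_cases hi : i ∈ P
    · rw [← hg2 ⟨i, hi⟩, ← hg2' ⟨i, hi⟩, hgg]
    · exact congrFun h.2 ⟨i, hi⟩

end Planting

/-! ### The first moment -/

lemma sq_le_two_pow_add (k : ℕ) : k ^ 2 ≤ 2 ^ (k + 5) := by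
  have h : k + 1 ≤ 2 ^ k := Nat.lt_two_pow_self
  rcases Nat.lt_or_ge k 5 with hk | hk
  · interval_cases k <;> norm_num
  · induction k, hk using Nat.le_induction with
    | base => norm_num
    | succ m hm ih =>
      have := ih Nat.lt_two_pow_self
      rw [show m + 1 + 5 = (m + 5) + 1 by ring, pow_succ 2 (m + 5)]
      nlinarith

/-- One binomial counts the position sets, the other the nodes shared with the planted tournament.
The delicate term is the last, one exchanged node, where `k²` candidates meet `2^{-(k+8)}`; all
other terms together are at most `2^{-14}`. -/
lemma sum_choose_sq_le (k : ℕ) :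
    ∑ m ∈ Finset.range k, (k.choose m : ℝ) * (k.choose m * (1 / 2) ^ ((k - m) * (m + 9))) ≤
      1 / 4 := by
  rcases k with _ | k
  · norm_num
  rw [Finset.sum_range_succ]
  have h1 : ∑ m ∈ Finset.range k, ((k + 1).choose m : ℝ) *
      ((k + 1).choose m * (1 / 2) ^ ((k + 1 - m) * (m + 9))) ≤ 1 / 8 := by
    calc ∑ m ∈ Finset.range k, ((k + 1).choose m : ℝ) *
        ((k + 1).choose m * (1 / 2) ^ ((k + 1 - m) * (m + 9)))
        ≤ ∑ m ∈ Finset.range k, ((k + 1).choose m : ℝ) *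
          (2 ^ (k + 1) * (1 / 2) ^ (2 * (k + 1) + 14)) := by
          refine Finset.sum_le_sum fun m hm => ?_
          have hmk := Finset.mem_range.1 hm
          refine mul_le_mul_of_nonneg_left
            (mul_le_mul ?_ ?_ (by positivity) (by positivity)) (by positivity)
          · exact_mod_cast Nat.choose_le_two_pow _ _
          · refine pow_le_pow_of_le_one (by norm_num) (by norm_num) ?_
            obtain ⟨r, rfl⟩ := Nat.exists_eq_add_of_lt hmk
            have : m + r + 1 + 1 - m = r + 2 := by omega
            rw [this]
            -- With at least two exchanged nodes the exponent is at least `2(k+1) + 14`, with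
            -- equality at exactly two.
            nlinarith [Nat.zero_le (r * m)]
      _ ≤ ∑ m ∈ Finset.range (k + 1 + 1), ((k + 1).choose m : ℝ) *
          (2 ^ (k + 1) * (1 / 2) ^ (2 * (k + 1) + 14)) := by
          refine Finset.sum_le_sum_of_subset_of_nonneg ?_ fun _ _ _ => by positivity
          intro m hm
          simp only [Finset.mem_range] at hm ⊢
          omega
      _ = 2 ^ (k + 1) * (2 ^ (k + 1) * (1 / 2) ^ (2 * (k + 1) + 14)) := by
          rw [← Finset.sum_mul]
          congr 1
          exact_mod_cast Nat.sum_range_choose (k + 1)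
      _ = (1 / 2) ^ 14 := by
          have h : (2 : ℝ) ^ (k + 1) * (1 / 2) ^ (k + 1) = 1 := by rw [← mul_pow]; norm_num
          rw [two_mul (k + 1), pow_add (1 / 2 : ℝ) (k + 1 + (k + 1)) 14,
            pow_add (1 / 2 : ℝ) (k + 1) (k + 1)]
          linear_combination (1 / 2) ^ 14 * ((2 : ℝ) ^ (k + 1) * (1 / 2) ^ (k + 1) + 1) * h
      _ ≤ 1 / 8 := by norm_num
  have h2 : ((k + 1).choose k : ℝ) * ((k + 1).choose k * (1 / 2) ^ ((k + 1 - k) * (k + 9))) ≤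
      1 / 8 := by
    have h3 : ((k + 1 : ℕ) : ℝ) ^ 2 ≤ 2 ^ (k + 1 + 5) := by exact_mod_cast sq_le_two_pow_add (k + 1)
    rw [Nat.choose_succ_self_right, Nat.add_sub_cancel_left, one_mul, ← mul_assoc, ← pow_two]
    calc ((k + 1 : ℕ) : ℝ) ^ 2 * (1 / 2) ^ (k + 9) ≤ 2 ^ (k + 1 + 5) * (1 / 2) ^ (k + 9) := by
          gcongr
      _ = ((2 : ℝ) ^ (k + 6) * (1 / 2) ^ (k + 6)) * (1 / 2) ^ 3 := by ring
      _ = 1 / 8 := by rw [← mul_pow]; norm_num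
  linarith

/-- Expected number of ways to fill the `r` free positions: substitute `n ≤ 2^{k-10}`. Of the saving
`10r`, one `r` is lost because a fresh pair joins distinct positions. -/
lemma pow_mul_half_pow_le {n k m r c : ℕ} (hn : 1024 * n ≤ 2 ^ k) (hk : m + r = k)
    (hc : c + r = r * (2 * m + r)) :
    (n : ℝ) ^ r * (1 / 2) ^ c ≤ (1 / 2) ^ (r * (m + 9)) := by
  have h1 : ((1024 * n : ℕ) : ℝ) ^ r ≤ ((2 : ℝ) ^ k) ^ r := by
    gcongr
    exact_mod_cast hn
  have h2 : (n : ℝ) ^ r ≤ 2 ^ (k * r) * (1 / 2) ^ (10 * r) := by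
    have h3 : (n : ℝ) = (1024 * n : ℕ) * (1 / 2) ^ 10 := by push_cast; ring
    rw [h3, mul_pow, ← pow_mul, pow_mul 2]
    gcongr
  calc (n : ℝ) ^ r * (1 / 2) ^ c ≤ 2 ^ (k * r) * (1 / 2) ^ (10 * r) * (1 / 2) ^ c := by gcongr
    _ = 2 ^ (k * r) * (1 / 2) ^ (k * r + r * (m + 9)) := by
        rw [mul_assoc, ← pow_add]
        congr 2
        subst hk
        nlinarith
    _ = (1 / 2) ^ (r * (m + 9)) := by
        rw [pow_add, ← mul_assoc, ← mul_pow]; norm_num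

namespace Planting

variable {V : Type*} [Fintype V] [DecidableEq V] {k : ℕ} (Q : Planting V k)

lemma pr_iUnion_candidates_le {n : ℕ} (hn : (Q.U ∪ Q.T)ᶜ.card ≤ n) (hnk : 1024 * n ≤ 2 ^ k)
    (hk : (k : ℝ) * (2 * (3 / 4) ^ k) ≤ 1 / 2) :
    pr (⋃ P ∈ (Finset.univ : Finset (Fin k)).ssubsets, ⋃ f ∈ Q.candidates P,
      Q.planted ∩ chain P f) ≤ pr Q.planted / 2 := by
  classical
  have hP : ∀ P : Finset (Fin k), pr (⋃ f ∈ Q.candidates P, Q.planted ∩ chain P f) ≤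
      2 * pr Q.planted * (k.choose P.card * (1 / 2) ^ ((k - P.card) * (P.card + 9))) := by
    intro P
    have hPk : P.card ≤ k := by simpa using Finset.card_le_univ P
    refine (pr_iUnion_le _ _).trans ((Finset.sum_le_card_nsmul _ _ _ fun f hf =>
      Candidate.pr_inter_le (by simpa [candidates] using hf) hk).trans ?_)
    rw [nsmul_eq_mul]
    have h1 : ((Q.candidates P).card : ℝ) ≤ k.choose P.card * (n : ℝ) ^ (k - P.card) := by
      exact_mod_cast Q.card_candidates_le P hn
    have h2 := pow_mul_half_pow_le (m := P.card) (r := k - P.card) hnk (by omega)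
      (card_freshPairs (P := P) (by omega))
    have h0 := pr_nonneg Q.planted
    calc ((Q.candidates P).card : ℝ) * (2 * pr Q.planted * (1 / 2) ^ (freshPairs P).card)
        ≤ (k.choose P.card * (n : ℝ) ^ (k - P.card)) *
          (2 * pr Q.planted * (1 / 2) ^ (freshPairs P).card) := by gcongr
      _ = 2 * pr Q.planted * (k.choose P.card *
          ((n : ℝ) ^ (k - P.card) * (1 / 2) ^ (freshPairs P).card)) := by ring
      _ ≤ _ := by gcongr
  refine (pr_iUnion_le _ _).trans ((Finset.sum_le_sum fun P _ => hP P).trans ?_)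
  rw [← Finset.mul_sum]
  have hsum : ∑ P ∈ (Finset.univ : Finset (Fin k)).ssubsets,
      ((k.choose P.card : ℝ) * (1 / 2) ^ ((k - P.card) * (P.card + 9))) ≤ 1 / 4 := by
    refine le_trans ?_ (sum_choose_sq_le k)
    -- Grouping the position sets by size supplies the second binomial. The full set, which is the
    -- planted tournament itself, contributes `1` and is removed.
    have h := Finset.sum_powerset_apply_card
      (fun m => (k.choose m : ℝ) * (1 / 2) ^ ((k - m) * (m + 9)))
      (x := (Finset.univ : Finset (Fin k)))
    rw [Finset.card_univ, Fintype.card_fin, Finset.sum_range_succ] at h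
    rw [Finset.ssubsets, ← Finset.sum_erase_add _ _ (Finset.mem_powerset_self _)] at *
    simp only [nsmul_eq_mul, Finset.card_univ, Fintype.card_fin, Nat.choose_self] at h
    norm_num at h ⊢
    linarith
  nlinarith [pr_nonneg Q.planted]

end Planting

namespace Planting

variable {V : Type*} [Fintype V] [DecidableEq V] {k : ℕ} (Q : Planting V k)

/-! ### Digraphs with a planted tournament -/

/-- The digraphs in which the planted tournament is the only one with `k` nodes and the attached
node classes are the planted ones. -/
def realized : Set (V × V → Bool) :=
  {ω | unlooped (ofBits ω) = Q.U ∧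
    {S | IsTournament (ofBits ω) S ∧ S.ncard = k} = {(Q.T : Set V)} ∧
    unloopedZero (ofBits ω) Q.T = Q.A ∧ unloopedConn (ofBits ω) Q.T = Q.A ∧
    loopedConn (ofBits ω) Q.T = Q.B}

variable {Q} {ω : V × V → Bool}

lemma bit_diag (hω : ω ∈ Q.fixed) (x : V) : ω (x, x) = true ↔ x ∉ Q.U := by
  rw [hω (x, x) (by simp [fixedPairs])]
  simp [fixedBit]

lemma bit_node (hω : ω ∈ Q.fixed) {i j : Fin k} (hij : i ≠ j) :
    ω (Q.node i, Q.node j) = true ↔ i < j := by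
  have hne : Q.node i ≠ Q.node j := fun h => hij (Q.node.injective h)
  rw [hω (Q.node i, Q.node j) (by simp [fixedPairs, node_mem_T])]
  simp [fixedBit, hne, node_mem_T]

lemma bit_D (hω : ω ∈ Q.fixed) {d t : V} (hd : d ∈ Q.D) (ht : t ∈ Q.T) :
    ω (d, t) = true ∧ ω (t, d) = true := by
  have hdT : d ∉ Q.T := fun h => Q.notMem_D_of_mem_T h hd
  have hne : d ≠ t := fun h => hdT (h ▸ ht)
  rw [hω (d, t) (by simp [fixedPairs, hd, ht]), hω (t, d) (by simp [fixedPairs, hd, ht])]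
  simp [fixedBit, hne, hne.symm, hdT]

lemma loose_of_notMem (hω : ω ∈ Q.planted) {y : V} (h1 : y ∉ Q.T) (h2 : y ∉ Q.D) :
    ω ∈ Q.loose y := Set.mem_iInter₂.1 hω.2 y (Q.mem_rest.2 ⟨h1, h2⟩)

lemma unlooped_eq (hω : ω ∈ Q.fixed) : unlooped (ofBits ω) = Q.U := by
  ext x
  have h : ¬ ω (x, x) = true ↔ x ∈ Q.U := by rw [bit_diag hω, not_not]
  exact h

lemma looped_iff (hω : ω ∈ Q.fixed) {x : V} : Looped (ofBits ω) x ↔ x ∉ Q.U := bit_diag hω x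

lemma isTournament_T (hω : ω ∈ Q.fixed) : IsTournament (ofBits ω) (Q.T : Set V) := by
  have hadj : ∀ i j, (ofBits ω).Adj (Q.node i) (Q.node j) ↔ i ≤ j := by
    intro i j
    by_cases hij : i = j
    · subst hij
      exact ⟨fun _ => le_rfl, fun _ => (bit_diag hω (Q.node i)).2 (Q.node_notMem_U i)⟩
    · exact (bit_node hω hij).trans ⟨le_of_lt, fun h => lt_of_le_of_ne h hij⟩
  refine ⟨fun x hx => ?_, fun x hx y hy hxy => ?_, fun x hx y hy z hz => ?_⟩
  · obtain ⟨i, rfl⟩ := Q.mem_T.1 hx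
    exact (hadj i i).2 le_rfl
  · obtain ⟨i, rfl⟩ := Q.mem_T.1 hx
    obtain ⟨j, rfl⟩ := Q.mem_T.1 hy
    have hij : i ≠ j := fun h => hxy (h ▸ rfl)
    rw [hadj, hadj, not_le]
    exact ⟨fun h => lt_of_le_of_ne h hij, le_of_lt⟩
  · obtain ⟨i, rfl⟩ := Q.mem_T.1 hx
    obtain ⟨j, rfl⟩ := Q.mem_T.1 hy
    obtain ⟨l, rfl⟩ := Q.mem_T.1 hz
    rw [hadj, hadj, hadj]
    exact le_trans

/-- Looseness excludes a node from both `U_0` and `U_T`, so one argument identifies both classes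
with `A`. -/
lemma mem_A_of_mem_U_of_not_loose (hω : ω ∈ Q.planted) {x : V} (hx : x ∈ Q.U)
    (hl : ω ∉ Q.loose x) : x ∈ Q.A := by
  by_contra hA
  refine hl (loose_of_notMem hω (fun h => Q.notMem_U_of_mem_T h hx) ?_)
  simp only [D, Finset.mem_union, not_or]
  exact ⟨hA, fun h => Finset.disjoint_left.1 Q.B_disjoint h hx⟩

lemma unloopedZero_eq (hω : ω ∈ Q.planted) : unloopedZero (ofBits ω) Q.T = Q.A := by
  ext x
  constructor
  · rintro ⟨h1, h2⟩
    rw [looped_iff hω.1, not_not] at h1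
    refine mem_A_of_mem_U_of_not_loose hω h1 ?_
    rintro ⟨-, t, ht, h3⟩
    exact h2 t ht h3
  · intro hx
    refine ⟨fun h => (looped_iff hω.1).1 h (Q.A_subset hx), fun s hs h => h.2 ?_⟩
    exact (bit_D hω.1 (Finset.mem_union_left _ hx) hs).2

lemma unloopedConn_eq (hω : ω ∈ Q.planted) : unloopedConn (ofBits ω) Q.T = Q.A := by
  ext x
  constructor
  · rintro ⟨h1, h2⟩
    rw [looped_iff hω.1, not_not] at h1
    refine mem_A_of_mem_U_of_not_loose hω h1 ?_
    rintro ⟨⟨t, ht, h3⟩, -⟩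
    exact h3 (h2 t ht)
  · intro hx
    refine ⟨fun h => (looped_iff hω.1).1 h (Q.A_subset hx), fun s hs => Or.inl ?_⟩
    exact (bit_D hω.1 (Finset.mem_union_left _ hx) hs).1

lemma loopedConn_eq (hω : ω ∈ Q.planted) : loopedConn (ofBits ω) Q.T = Q.B := by
  ext x
  constructor
  · rintro ⟨h1, h2, h3⟩
    rw [looped_iff hω.1] at h1
    by_contra hB
    obtain ⟨⟨t, ht, h4⟩, -⟩ := loose_of_notMem hω (y := x) h2 (by
      simp only [D, Finset.mem_union, not_or]
      exact ⟨fun h => h1 (Q.A_subset h), hB⟩)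
    exact h4 (h3 t ht)
  · intro hx
    have hxD : x ∈ Q.D := Finset.mem_union_right _ hx
    exact ⟨(looped_iff hω.1).2 fun h => Finset.disjoint_left.1 Q.B_disjoint hx h,
      fun h => Q.notMem_D_of_mem_T h hxD, fun s hs => Or.inl (bit_D hω.1 hxD hs).1⟩

/-- Another tournament of `k` nodes is one of the candidates. -/
lemma exists_candidate (hω : ω ∈ Q.planted) {S : Set V} (hS : IsTournament (ofBits ω) S)
    (hSk : S.ncard = k) (hST : S ≠ Q.T) :
    ∃ P, P ⊂ Finset.univ ∧ ∃ f, Q.Candidate P f ∧ ω ∈ chain P f := by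
  classical
  obtain ⟨f, hinj, hrange, hf⟩ := hS.exists_enum hSk
  have hnot : ∀ {i j : Fin k}, i ≠ j →
      ¬ ((ofBits ω).Adj (f i) (f j) ∧ (ofBits ω).Adj (f j) (f i)) := by
    rintro i j hij ⟨h1, h2⟩
    rcases lt_or_gt_of_ne hij with h | h
    · exact (hf i j h).2 h2
    · exact (hf j i h).2 h1
  let P : Finset (Fin k) := Finset.univ.filter fun i => f i ∈ Q.T
  have hP : ∀ i, f i ∈ Q.T ↔ i ∈ P := fun i => by simp [P]
  refine ⟨P, ?_, f, ⟨hinj, fun i => ?_, hP, ?_, ?_⟩, ?_⟩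
  · rw [Finset.ssubset_univ_iff]
    intro hPu
    refine hST (Set.eq_of_subset_of_ncard_le ?_ ?_)
    · rw [← hrange]
      rintro _ ⟨i, rfl⟩
      exact (hP i).2 (hPu ▸ Finset.mem_univ i)
    · rw [Set.ncard_coe_finset, Q.card_T, hSk]
  · exact (looped_iff hω.1).1 (hS.1 (f i) (hrange ▸ Set.mem_range_self i))
  · rintro ⟨j, hj⟩ i hi
    refine Q.mem_rest.2 ⟨fun h => hi ((hP i).1 h), fun h => ?_⟩
    have hij : i ≠ j := fun h => hi (h ▸ hj)
    -- A node of `D` has double edges to all of `T`, so no tournament contains it together with a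
    -- node of `T`.
    exact hnot hij (bit_D hω.1 h ((hP j).2 hj))
  · intro i _ j _ hij a b ha hb
    have h1 := (hf i j hij).1
    have hab : a ≠ b := fun h => hij.ne (hinj (by rw [← ha, ← hb, h]))
    rw [← ha, ← hb] at h1
    exact (bit_node hω.1 hab).1 h1
  · rintro ⟨i, j⟩ he
    have hij := (mem_freshPairs.1 he).1
    rcases lt_or_gt_of_ne hij with h | h
    · have h1 : ω (f i, f j) = true := (hf i j h).1
      simp only [h1, h, decide_true]
    · have h1 : ¬ ω (f i, f j) = true := (hf j i h).2
      simp only [Bool.eq_false_iff.2 h1, not_lt_of_gt h, decide_false]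

variable (Q)

/-- A planted digraph can fail to be realized only through a second `k`-node tournament, that is, a
candidate chain; the first moment bounds this by half of the planted probability. -/
theorem le_pr_realized {n : ℕ} (hn : (Q.U ∪ Q.T)ᶜ.card ≤ n) (hnk : 1024 * n ≤ 2 ^ k)
    (hk : (k : ℝ) * (2 * (3 / 4) ^ k) ≤ 1 / 2) : pr Q.planted / 2 ≤ pr Q.realized := by
  have h1 := Q.pr_iUnion_candidates_le hn hnk hk
  have h2 := pr_le_add_pr_diff Q.planted Q.realized
  have h3 : pr (Q.planted \ Q.realized) ≤ pr (⋃ P ∈ (Finset.univ : Finset (Fin k)).ssubsets,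
      ⋃ f ∈ Q.candidates P, Q.planted ∩ chain P f) := by
    refine pr_mono ?_
    rintro ω ⟨hω, hn⟩
    obtain ⟨S, hS, hSk, hST⟩ : ∃ S, IsTournament (ofBits ω) S ∧ S.ncard = k ∧ S ≠ Q.T := by
      by_contra! hall
      refine hn ⟨unlooped_eq hω.1, ?_, unloopedZero_eq hω, unloopedConn_eq hω, loopedConn_eq hω⟩
      ext S
      constructor
      · rintro ⟨h4, h5⟩
        exact hall S h4 h5
      · rintro rfl
        exact ⟨isTournament_T hω.1, by rw [Set.ncard_coe_finset, Q.card_T]⟩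
    obtain ⟨P, hP, f, hf, hc⟩ := exists_candidate hω hS hSk hST
    simp only [Set.mem_iUnion]
    exact ⟨P, Finset.mem_ssubsets.2 hP, f, by simpa [candidates] using hf, hω, hc⟩
  linarith

end Planting

/-! ### Asymptotics of the parameters -/

lemma exp_neg_two_mul_le_one_sub {x : ℝ} (h0 : 0 ≤ x) (h1 : x ≤ 1 / 2) :
    Real.exp (-(2 * x)) ≤ 1 - x := by
  have h2 := Real.add_one_le_exp (2 * x)
  rw [Real.exp_neg, inv_le_comm₀ (Real.exp_pos _) (by linarith)]
  refine le_trans ?_ h2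
  rw [inv_le_comm₀ (by linarith) (by linarith), inv_eq_one_div, div_le_iff₀ (by linarith)]
  nlinarith

lemma half_pow_ge (m : ℕ) : Real.exp (-(m : ℝ)) ≤ (1 / 2 : ℝ) ^ m := by
  have h : Real.exp (-1) ≤ 1 / 2 := by
    rw [Real.exp_neg, one_div]
    gcongr
    linarith [Real.add_one_le_exp (1 : ℝ)]
  calc Real.exp (-(m : ℝ)) = Real.exp (-1) ^ m := by rw [← Real.exp_nat_mul]; ring_nf
    _ ≤ _ := by gcongr

/-- With `s = (3/2)^k`, the right side is at least `exp(-(k + k² + 2ks + s + 1))`. The left side is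
at most `exp(k - X)`, and `X ≥ 16sk²` because `2^k = s(4/3)^k`. -/
lemma error_le {k n N d : ℕ} (hk : 10000 ≤ k) (hL : (2 : ℝ) ^ 26 * k ^ 4 ≤ (4 / 3) ^ k)
    (hn1 : 1024 * n ≤ 2 ^ k) (hn2 : 2 ^ k ≤ 4096 * n) (hkn : k ≤ n) (hN : N ≤ 2 * n + k)
    (hd : (d : ℝ) ≤ (3 / 2) ^ k) :
    N * (2 * Real.exp (-(n : ℝ) / (1024 * k ^ 2))) + 2 * (4 ^ N * (3 / 4) ^ (k * n / 200)) ≤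
      Real.exp (-(k : ℝ)) *
        ((1 / 2) ^ (k ^ 2 + 2 * k * d) * (1 - 2 * (3 / 4) ^ k) ^ N / 2) := by
  have hkR : (10000 : ℝ) ≤ k := by exact_mod_cast hk
  have hknR : (k : ℝ) ≤ n := by exact_mod_cast hkn
  have hn1R : 1024 * (n : ℝ) ≤ 2 ^ k := by exact_mod_cast hn1
  have hn2R : (2 : ℝ) ^ k ≤ 4096 * n := by exact_mod_cast hn2
  have hNR : (N : ℝ) ≤ 3 * n := by
    have : N ≤ 3 * n := by omega
    exact_mod_cast this
  set s : ℝ := (3 / 2) ^ k with hs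
  have hs1 : 1 ≤ s := one_le_pow₀ (by norm_num)
  have h2k : (2 : ℝ) ^ k = s * (4 / 3) ^ k := by rw [hs, ← mul_pow]; norm_num
  set X : ℝ := (n : ℝ) / (1024 * k ^ 2) with hX
  have hXge : 16 * s * k ^ 2 ≤ X := by
    rw [hX, le_div_iff₀ (by positivity)]
    have : s * (2 ^ 26 * k ^ 4) ≤ 4096 * n := by
      refine le_trans ?_ hn2R
      rw [h2k]; gcongr
    nlinarith
  have hXn : X ≤ n := by
    rw [hX]
    exact div_le_self (by positivity) (by nlinarith)
  have hq : (3 / 4 : ℝ) ^ k ≤ 1 / 4 := by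
    calc (3 / 4 : ℝ) ^ k ≤ (3 / 4) ^ 5 := pow_le_pow_of_le_one (by norm_num) (by norm_num) (by omega)
      _ ≤ 1 / 4 := by norm_num
  -- the right hand side
  have hR1 : Real.exp (-s) ≤ (1 - 2 * (3 / 4 : ℝ) ^ k) ^ N := by
    have h1 := exp_neg_two_mul_le_one_sub (x := 2 * (3 / 4 : ℝ) ^ k) (by positivity) (by linarith)
    calc Real.exp (-s) ≤ Real.exp (N * -(2 * (2 * (3 / 4 : ℝ) ^ k))) := by
          apply Real.exp_le_exp.2
          have h2 : (3 / 4 : ℝ) ^ k * 2 ^ k = s := by rw [hs, ← mul_pow]; norm_num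
          have h3 : (3 / 4 : ℝ) ^ k * (1024 * n) ≤ s := by rw [← h2]; gcongr
          have h4 : (3 / 4 : ℝ) ^ k * N ≤ (3 / 4) ^ k * (3 * n) := by gcongr
          nlinarith
      _ = Real.exp (-(2 * (2 * (3 / 4 : ℝ) ^ k))) ^ N := by rw [Real.exp_nat_mul]
      _ ≤ _ := by gcongr
  have hR2 : Real.exp (-((k : ℝ) ^ 2 + 2 * k * s)) ≤ (1 / 2 : ℝ) ^ (k ^ 2 + 2 * k * d) := by
    refine le_trans (Real.exp_le_exp.2 ?_) (half_pow_ge _)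
    push_cast
    have : 2 * (k : ℝ) * d ≤ 2 * k * s := by gcongr
    linarith
  have hR3 : Real.exp (-1) ≤ 1 / 2 := by simpa using half_pow_ge 1
  have hR : Real.exp (-(k : ℝ)) * (Real.exp (-((k : ℝ) ^ 2 + 2 * k * s)) * Real.exp (-s) *
      Real.exp (-1)) ≤ Real.exp (-(k : ℝ)) *
        ((1 / 2) ^ (k ^ 2 + 2 * k * d) * (1 - 2 * (3 / 4) ^ k) ^ N / 2) := by
    rw [div_eq_mul_one_div]
    have h0 : 0 ≤ 1 - 2 * (3 / 4 : ℝ) ^ k := by linarith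
    gcongr
  refine le_trans ?_ hR
  -- the left hand side
  have hL1 : N * (2 * Real.exp (-(n : ℝ) / (1024 * k ^ 2))) ≤ 6 * n * Real.exp (-X) := by
    have : -(n : ℝ) / (1024 * k ^ 2) = -X := by rw [hX, neg_div]
    rw [this]
    nlinarith [Real.exp_pos (-X)]
  have hL2 : (2 : ℝ) * (4 ^ N * (3 / 4) ^ (k * n / 200)) ≤ 2 * Real.exp (-X) := by
    have h4 : (4 : ℝ) ≤ Real.exp 2 := by
      have h1 := Real.add_one_le_exp (1 : ℝ)
      have h2 : Real.exp 2 = Real.exp 1 * Real.exp 1 := by rw [← Real.exp_add]; norm_num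
      nlinarith
    have h5 : (4 : ℝ) ^ N ≤ Real.exp (6 * n) := by
      calc (4 : ℝ) ^ N ≤ Real.exp 2 ^ N := by gcongr
        _ = Real.exp (N * 2) := by rw [Real.exp_nat_mul]
        _ ≤ _ := Real.exp_le_exp.2 (by linarith)
    have h6 : (3 / 4 : ℝ) ≤ Real.exp (-(1 / 4)) := by
      linarith [Real.add_one_le_exp (-(1 / 4) : ℝ)]
    have h7 : (3 / 4 : ℝ) ^ (k * n / 200) ≤ Real.exp (-(25 / 2 * n)) := by
      -- Here `k ≥ 10000` is needed: `(3/4)^(50n)` must outweigh the `4^N ≤ exp(6n)` choices and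
      -- still leave `exp(-n)`.
      have hM : 50 * n ≤ k * n / 200 := by
        rw [Nat.le_div_iff_mul_le (by norm_num)]
        nlinarith
      calc (3 / 4 : ℝ) ^ (k * n / 200) ≤ (3 / 4) ^ (50 * n) :=
            pow_le_pow_of_le_one (by norm_num) (by norm_num) hM
        _ ≤ Real.exp (-(1 / 4)) ^ (50 * n) := by gcongr
        _ = Real.exp (-(25 / 2 * n)) := by
            rw [← Real.exp_nat_mul]; congr 1; push_cast; ring
    have h8 : (4 : ℝ) ^ N * (3 / 4) ^ (k * n / 200) ≤ Real.exp (-X) := by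
      calc (4 : ℝ) ^ N * (3 / 4) ^ (k * n / 200)
          ≤ Real.exp (6 * n) * Real.exp (-(25 / 2 * n)) := by gcongr
        _ = Real.exp (6 * n + -(25 / 2 * n)) := by rw [Real.exp_add]
        _ ≤ _ := Real.exp_le_exp.2 (by linarith)
    linarith
  have hL3 : 6 * (n : ℝ) + 2 ≤ Real.exp k := by
    have h1 : (2 : ℝ) ^ k ≤ Real.exp k := by
      calc (2 : ℝ) ^ k ≤ Real.exp 1 ^ k := by
            gcongr
            linarith [Real.add_one_le_exp (1 : ℝ)]
        _ = Real.exp k := by rw [← Real.exp_nat_mul]; simp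
    linarith
  calc _ ≤ (6 * (n : ℝ) + 2) * Real.exp (-X) := by linarith
    _ ≤ Real.exp k * Real.exp (-X) := by gcongr
    _ ≤ _ := by
        rw [← Real.exp_add, ← Real.exp_add, ← Real.exp_add, ← Real.exp_add]
        apply Real.exp_le_exp.2
        nlinarith [mul_le_mul hs1 hkR (by norm_num) (by linarith),
          mul_le_mul_of_nonneg_left hkR (show (0 : ℝ) ≤ s * k by positivity),
          mul_le_mul_of_nonneg_right hs1 (show (0 : ℝ) ≤ (k : ℝ) ^ 2 by positivity)]

/-- `k` is so large that all estimates hold. -/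
def LargeK (k : ℕ) : Prop := 10000 ≤ k ∧ (2 : ℝ) ^ 26 * k ^ 4 ≤ (4 / 3) ^ k

lemma eventually_largeK : ∀ᶠ k : ℕ in atTop, LargeK k := by
  have h := tendsto_pow_const_div_const_pow_of_one_lt 4 (show (1 : ℝ) < 4 / 3 by norm_num)
  have h1 := h.eventually (gt_mem_nhds (show (0 : ℝ) < 1 / 2 ^ 26 by norm_num))
  filter_upwards [h1, eventually_ge_atTop 10000] with k h2 h3
  refine ⟨h3, ?_⟩
  rw [div_lt_div_iff₀ (by positivity) (by positivity)] at h2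
  linarith

lemma tendsto_kOf : Tendsto kOf atTop atTop := by
  have h1 : Tendsto (fun p : ℕ => 4 * (p : ℝ) ^ 2) atTop atTop :=
    Tendsto.const_mul_atTop (by norm_num)
      ((tendsto_pow_atTop two_ne_zero).comp tendsto_natCast_atTop_atTop)
  have h2 := (Real.tendsto_logb_atTop (show (1 : ℝ) < 3 / 2 by norm_num)).comp h1
  exact tendsto_nat_ceil_atTop.comp h2

lemma four_mul_sq_le (p : ℕ) : (4 * (p : ℝ) ^ 2) ≤ (3 / 2) ^ kOf p := by
  rcases Nat.eq_zero_or_pos p with rfl | hp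
  · norm_num
  have hp' : (0 : ℝ) < 4 * (p : ℝ) ^ 2 := by positivity
  have h := Nat.le_ceil (Real.logb (3 / 2) (4 * (p : ℝ) ^ 2))
  rw [Real.logb_le_iff_le_rpow (by norm_num) hp', Real.rpow_natCast] at h
  exact h

lemma nOf_mul_le (p : ℕ) : 1024 * nOf p ≤ 2 ^ kOf p := by
  have h : (nOf p : ℝ) ≤ (2 : ℝ) ^ ((kOf p : ℝ) - (10 + 1 / 6)) := Nat.floor_le (by positivity)
  have h1 : (2 : ℝ) ^ ((kOf p : ℝ) - (10 + 1 / 6)) ≤ (2 : ℝ) ^ kOf p / 2 ^ 10 := by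
    rw [← Real.rpow_natCast, ← Real.rpow_natCast, ← Real.rpow_sub (by norm_num)]
    apply Real.rpow_le_rpow_of_exponent_le (by norm_num)
    push_cast; linarith
  have h2 : 1024 * (nOf p : ℝ) ≤ 2 ^ kOf p := by
    have := h.trans h1
    rw [le_div_iff₀ (by positivity)] at this
    linarith
  exact_mod_cast h2

/-- Of the exponent `c` only `10 ≤ c ≤ 11` matters: the lower bound drives the first moment, the
upper bound keeps `n` of order `2^k`. -/
lemma two_pow_kOf_lt (p : ℕ) : 2 ^ kOf p < 2048 * (nOf p + 1) := by
  have h : (2 : ℝ) ^ ((kOf p : ℝ) - (10 + 1 / 6)) < nOf p + 1 := Nat.lt_floor_add_one _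
  have h1 : (2 : ℝ) ^ kOf p / 2 ^ 11 ≤ (2 : ℝ) ^ ((kOf p : ℝ) - (10 + 1 / 6)) := by
    rw [← Real.rpow_natCast, ← Real.rpow_natCast, ← Real.rpow_sub (by norm_num)]
    apply Real.rpow_le_rpow_of_exponent_le (by norm_num)
    push_cast; linarith
  have h2 : (2 : ℝ) ^ kOf p < 2048 * (nOf p + 1) := by
    have := h1.trans_lt h
    rw [div_lt_iff₀ (by positivity)] at this
    linarith
  exact_mod_cast h2

section

variable {p : ℕ}

lemma LargeK.two_pow_le (hp : LargeK (kOf p)) : 2 ^ kOf p ≤ 4096 * nOf p := by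
  have h := two_pow_kOf_lt p
  have h1 : 2 ^ 12 ≤ 2 ^ kOf p := Nat.pow_le_pow_right (by norm_num) (by have := hp.1; omega)
  omega

lemma LargeK.le_nOf (hp : LargeK (kOf p)) : (2 : ℝ) ^ 14 * (3 / 2) ^ kOf p * (kOf p) ^ 4 ≤ nOf p := by
  have h : (2 : ℝ) ^ kOf p ≤ 4096 * nOf p := by exact_mod_cast LargeK.two_pow_le hp
  have h2k : (2 : ℝ) ^ kOf p = (3 / 2) ^ kOf p * (4 / 3) ^ kOf p := by rw [← mul_pow]; norm_num
  rw [h2k] at h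
  have := mul_le_mul_of_nonneg_left hp.2 (show (0 : ℝ) ≤ (3 / 2) ^ kOf p by positivity)
  linarith

lemma LargeK.kOf_le_nOf (hp : LargeK (kOf p)) : kOf p ≤ nOf p := by
  have h := LargeK.le_nOf hp
  have hk : (10000 : ℝ) ≤ kOf p := by exact_mod_cast hp.1
  have h1 : (1 : ℝ) ≤ (3 / 2) ^ kOf p := one_le_pow₀ (by norm_num)
  have h2 : (kOf p : ℝ) ≤ (kOf p : ℝ) ^ 4 := le_self_pow₀ (by linarith) (by norm_num)
  have h3 : (kOf p : ℝ) ≤ nOf p := by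
    refine le_trans ?_ h
    nlinarith
  exact_mod_cast h3

lemma LargeK.two_mul_sq_le_nOf (hp : LargeK (kOf p)) : 2 * p ^ 2 ≤ nOf p := by
  have h := LargeK.le_nOf hp
  have hk : (1 : ℝ) ≤ kOf p := by
    have := hp.1
    exact_mod_cast (by omega : 1 ≤ kOf p)
  have h2 : (1 : ℝ) ≤ (kOf p : ℝ) ^ 4 := one_le_pow₀ hk
  have h3 := four_mul_sq_le p
  have h4 : 2 * (p : ℝ) ^ 2 ≤ nOf p := by
    refine le_trans ?_ h
    nlinarith [sq_nonneg (p : ℝ)]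
  exact_mod_cast h4

lemma LargeK.mul_pow_le (hp : LargeK (kOf p)) : (kOf p : ℝ) * (2 * (3 / 4) ^ kOf p) ≤ 1 / 2 := by
  have h := hp.2
  have hk : (1 : ℝ) ≤ kOf p := by
    have := hp.1
    exact_mod_cast (by omega : 1 ≤ kOf p)
  have h2 : (kOf p : ℝ) ≤ (kOf p : ℝ) ^ 4 := le_self_pow₀ hk (by norm_num)
  have h3 : (3 / 4 : ℝ) ^ kOf p * (4 / 3) ^ kOf p = 1 := by rw [← mul_pow]; norm_num
  have h4 : (0 : ℝ) < (3 / 4) ^ kOf p := by positivity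
  nlinarith [mul_le_mul_of_nonneg_left h h4.le, mul_le_mul_of_nonneg_left h2 h4.le]

end

/-! ### The cells of `𝒩` with given un-looped nodes and given tournament -/

lemma pr_union_of_disjoint {ι : Type*} [Fintype ι] [DecidableEq ι] {A B : Set (ι → Bool)}
    (h : Disjoint A B) : pr (A ∪ B) = pr A + pr B := by
  simp only [pr_eq_ncard, ← add_div, Set.ncard_union_eq h, Nat.cast_add]

lemma sum_pr_le_of_disjoint {ι κ : Type*} [Fintype ι] [DecidableEq ι] (J : Finset κ)
    (A : κ → Set (ι → Bool)) (hd : (J : Set κ).PairwiseDisjoint A) :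
    ∑ j ∈ J, pr (A j) ≤ pr (⋃ j ∈ J, A j) := by
  classical
  induction J using Finset.induction_on with
  | empty => simpa using pr_nonneg _
  | insert a J ha ih =>
    rw [Finset.set_biUnion_insert, Finset.sum_insert ha, pr_union_of_disjoint]
    · gcongr
      exact ih (hd.subset (by simp))
    · simp only [Set.disjoint_iUnion_right]
      intro j hj
      exact hd (by simp) (by simp [hj]) fun h => ha (h ▸ hj)

/-- The digraphs in `𝒩_p` with un-looped nodes `U` and tournament `T`. -/
def cell (p : ℕ) (U T : Finset (Fin (numNodes p))) :
    Set (Fin (numNodes p) × Fin (numNodes p) → Bool) :=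
  {ω | ofBits ω ∈ classN p ∧ unlooped (ofBits ω) = U ∧
    {S | IsTournament (ofBits ω) S ∧ S.ncard = kOf p} = {(T : Set (Fin (numNodes p)))}}

variable {p : ℕ}

/-- Any order of `T` and any sets `A`, `B` of the right sizes will do, since only a lower bound for
the cell is wanted. -/
lemma exists_planting (hp : LargeK (kOf p)) {U T : Finset (Fin (numNodes p))}
    (hU : U.card = nOf p) (hT : T.card = kOf p) (hUT : Disjoint U T) :
    ∃ Q : Planting (Fin (numNodes p)) (kOf p), Q.U = U ∧ Q.T = T ∧ Q.A.card = 2 * p ^ 2 ∧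
      Q.B.card + 1 = 2 * p ^ 2 ∧ (Q.U ∪ Q.T)ᶜ.card + 1 = nOf p := by
  -- For `p = 0` the logarithm takes the default value `0`, so `k = 0`. Positivity of `p` makes `2p²
  -- - 1` a genuine difference.
  have hp0 : p ≠ 0 := by
    rintro rfl
    have := hp.1
    simp [kOf] at this
  have hp1 : 1 ≤ p ^ 2 := Nat.one_le_pow _ _ (Nat.pos_of_ne_zero hp0)
  have h1 := LargeK.two_mul_sq_le_nOf hp
  have h2 := LargeK.kOf_le_nOf hp
  have h3 := hp.1
  have hc : (U ∪ T)ᶜ.card + 1 = nOf p := by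
    rw [Finset.card_compl, Finset.card_union_of_disjoint hUT, hU, hT, Fintype.card_fin, numNodes]
    omega
  obtain ⟨A, hAU, hA⟩ := Finset.exists_subset_card_eq (show 2 * p ^ 2 ≤ U.card by omega)
  obtain ⟨B, hBU, hB⟩ := Finset.exists_subset_card_eq
    (show 2 * p ^ 2 - 1 ≤ (U ∪ T)ᶜ.card by omega)
  have hB' : ∀ x ∈ B, x ∉ U ∧ x ∉ T := fun x hx => by simpa using hBU hx
  let e := T.orderEmbOfFin hT
  have he : ∀ i, e i ∈ T := fun i => Finset.orderEmbOfFin_mem T hT i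
  let Q : Planting (Fin (numNodes p)) (kOf p) :=
    { node := e.toEmbedding
      U := U
      A := A
      B := B
      A_subset := hAU
      B_disjoint := Finset.disjoint_left.2 fun x hx => (hB' x hx).1
      node_notMem_U := fun i h => Finset.disjoint_left.1 hUT h (he i)
      node_notMem_B := fun i h => (hB' _ h).2 (he i) }
  have hQT : Q.T = T := by
    refine Finset.eq_of_subset_of_card_le ?_ ?_
    · intro x hx
      obtain ⟨i, rfl⟩ := Q.mem_T.1 hx
      exact he i
    · rw [Q.card_T, hT]
  refine ⟨Q, rfl, hQT, hA, ?_, ?_⟩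
  · change B.card + 1 = _
    omega
  · rw [hQT]; exact hc

lemma realized_subset_cell (Q : Planting (Fin (numNodes p)) (kOf p)) (hU : Q.U.card = nOf p)
    (hA : Q.A.card = 2 * p ^ 2) (hB : Q.B.card + 1 = 2 * p ^ 2)
    (hc : (Q.U ∪ Q.T)ᶜ.card + 1 = nOf p) : Q.realized ⊆ cell p Q.U Q.T := by
  rintro ω ⟨h1, h2, h3, h4, h5⟩
  refine ⟨⟨Q.T, h2, ?_, ?_, ?_, ?_, ?_⟩, h1, h2⟩
  · rw [h1, Set.ncard_coe_finset, hU]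
  · have h6 : loopedOff (ofBits ω) Q.T = ((Q.U ∪ Q.T)ᶜ : Finset (Fin (numNodes p))) := by
      ext x
      have h7 : ¬ Looped (ofBits ω) x ↔ x ∈ (Q.U : Set (Fin (numNodes p))) := by
        rw [← h1]; rfl
      rw [not_iff_comm, Finset.mem_coe] at h7
      simp only [loopedOff, Set.mem_ofPred_eq, ← h7, Finset.coe_compl, Finset.coe_union,
        Set.mem_compl_iff, Set.mem_union, Finset.mem_coe, not_or]
    rw [h6, Set.ncard_coe_finset, hc]
  · rw [h3, Set.ncard_coe_finset, hA]
  · rw [h4, Set.ncard_coe_finset, hA]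
  · rw [h5, Set.ncard_coe_finset, hB]

lemma pr_unlooped_inter_not_quasirandom {V : Type*} [Fintype V] [DecidableEq V] (U : Finset V)
    (n k : ℕ) :
    pr {ω : V × V → Bool | unlooped (ofBits ω) = U ∧ ¬ Quasirandom (ofBits ω) U n k} =
      (1 / 2) ^ Fintype.card V * pr {ω : V × V → Bool | ¬ Quasirandom (ofBits ω) U n k} := by
  let b : V → Bool := fun x => decide (x ∉ U)
  have h1 : {ω : V × V → Bool | unlooped (ofBits ω) = U ∧ ¬ Quasirandom (ofBits ω) U n k} =
      {ω | ∀ x ∈ (Finset.univ : Finset V), ω (x, x) = b x} ∩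
        {ω | ¬ Quasirandom (ofBits ω) U n k} := by
    ext ω
    refine and_congr_left fun _ => ?_
    rw [Set.ext_iff]
    refine forall_congr' fun x => ?_
    simp only [unlooped, Looped, ofBits, Set.mem_ofPred_eq, Finset.mem_coe, Finset.mem_univ,
      true_implies, b]
    by_cases hx : x ∈ U <;> simp [hx]
  rw [h1, pr_inter (s := {e | e.1 = e.2}) (t := {e | e.1 ≠ e.2}) _ (dependsOn_quasirandom _ _ _),
    pr_bits Finset.univ (fun x => (x, x)) _ b, Finset.card_univ]
  · exact fun x _ y _ h => congrArg Prod.fst h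
  · rw [Set.disjoint_left]
    exact fun e h h' => h' h
  · intro ω ω' h
    simp only [Set.mem_ofPred_eq, eq_iff_iff]
    exact forall₂_congr fun x _ => by rw [h (x, x) rfl]

/-- Both probabilities carry the factor `2^{-N}` (`N` the number of nodes) for the loops, which
cancels; `error_le` compares what remains. -/
lemma pr_not_quasirandom_le_cell (hp : LargeK (kOf p)) {U T : Finset (Fin (numNodes p))}
    (hU : U.card = nOf p) (hT : T.card = kOf p) (hUT : Disjoint U T) :
    0 < pr (cell p U T) ∧
    pr {ω : Fin (numNodes p) × Fin (numNodes p) → Bool | unlooped (ofBits ω) = U ∧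
      ¬ Quasirandom (ofBits ω) U (nOf p) (kOf p)} ≤
      Real.exp (-(kOf p : ℝ)) * pr (cell p U T) := by
  obtain ⟨Q, rfl, rfl, hA, hB, hc⟩ := exists_planting hp hU hT hUT
  have hmul := LargeK.mul_pow_le hp
  have hk1 : (1 : ℝ) ≤ kOf p := by
    have := hp.1
    exact_mod_cast (by omega : 1 ≤ kOf p)
  have hq : 2 * (3 / 4 : ℝ) ^ kOf p ≤ 1 := by
    have : (0 : ℝ) ≤ 2 * (3 / 4) ^ kOf p := by positivity
    nlinarith
  set W : ℝ := (1 / 2) ^ ((kOf p) ^ 2 + 2 * kOf p * Q.D.card) *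
    (1 - 2 * (3 / 4) ^ kOf p) ^ numNodes p / 2 with hW
  have hcell : (1 / 2) ^ numNodes p * W ≤ pr (cell p Q.U Q.T) := by
    have h1 := Q.le_pr_planted hq
    have h2 := Q.le_pr_realized (n := nOf p) (by omega) (nOf_mul_le p) hmul
    have h3 := pr_mono (realized_subset_cell Q hU hA hB hc)
    refine le_trans ?_ (h2.trans h3)
    rw [Fintype.card_fin, add_assoc, pow_add, mul_assoc] at h1
    rw [hW, mul_div_assoc']
    linarith
  have hD : (Q.D.card : ℝ) ≤ (3 / 2) ^ kOf p := by
    refine le_trans ?_ (four_mul_sq_le p)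
    have : Q.D.card ≤ 4 * p ^ 2 := (Finset.card_union_le _ _).trans (by omega)
    exact_mod_cast this
  have herr := error_le (N := numNodes p) (d := Q.D.card) hp.1 hp.2 (nOf_mul_le p)
    (LargeK.two_pow_le hp) (LargeK.kOf_le_nOf hp) (by rw [numNodes]; omega) hD
  have hWpos : 0 < W := by
    have h1 : 0 < Real.exp (-(kOf p : ℝ)) * W := lt_of_lt_of_le (by positivity) herr
    exact pos_of_mul_pos_right h1 (Real.exp_pos _).le
  have hqr := pr_not_quasirandom_le Q.U (k := kOf p) (by have := hp.1; omega)
  rw [hU, Fintype.card_fin] at hqr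
  refine ⟨lt_of_lt_of_le (by positivity) hcell, ?_⟩
  rw [pr_unlooped_inter_not_quasirandom, Fintype.card_fin]
  calc (1 / 2 : ℝ) ^ numNodes p * _ ≤ (1 / 2) ^ numNodes p * (Real.exp (-(kOf p : ℝ)) * W) := by
        gcongr
        exact hqr.trans herr
    _ = Real.exp (-(kOf p : ℝ)) * ((1 / 2) ^ numNodes p * W) := by ring
    _ ≤ _ := by gcongr

/-! ### Almost every digraph -/

lemma ofBits_bijective {V : Type*} : Function.Bijective (ofBits (V := V)) := by
  classical
  constructor
  · intro ω ω' h
    ext ⟨x, y⟩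
    have := congrArg (fun G => G.Adj x y) h
    simp only [ofBits, eq_iff_iff] at this
    exact Bool.eq_iff_iff.2 this
  · intro G
    refine ⟨fun e => decide (G.Adj e.1 e.2), ?_⟩
    ext x y
    simp [ofBits]

lemma ncard_eq_pr_mul {V : Type*} [Fintype V] [DecidableEq V] (C : Set (Digraph V)) :
    (C.ncard : ℝ) = pr (ofBits ⁻¹' C) * 2 ^ Fintype.card (V × V) := by
  rw [pr_eq_ncard, div_mul_cancel₀ _ (by positivity),
    Set.ncard_preimage_of_injective_subset_range ofBits_bijective.1
      (by rw [ofBits_bijective.2.range_eq]; exact Set.subset_univ _)]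

theorem one_sub_exp_le_ratio (hp : LargeK (kOf p)) :
    1 - Real.exp (-(kOf p : ℝ)) ≤
      ({G ∈ classN p | BlanksForced G p}.ncard : ℝ) / ((classN p).ncard : ℝ) := by
  classical
  have hk := hp.1
  have hkn := LargeK.kOf_le_nOf hp
  let J : Finset (Finset (Fin (numNodes p)) × Finset (Fin (numNodes p))) :=
    Finset.univ.filter fun c => c.1.card = nOf p ∧ c.2.card = kOf p ∧ Disjoint c.1 c.2
  let C : Set (Fin (numNodes p) × Fin (numNodes p) → Bool) := ofBits ⁻¹' classN p
  let F : Set (Fin (numNodes p) × Fin (numNodes p) → Bool) :=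
    ofBits ⁻¹' {G ∈ classN p | BlanksForced G p}
  have hJ : ∀ c ∈ J, c.1.card = nOf p ∧ c.2.card = kOf p ∧ Disjoint c.1 c.2 := fun c hc => by
    simpa [J] using hc
  have hcells : ⋃ c ∈ J, cell p c.1 c.2 ⊆ C := by
    intro ω hω
    simp only [Set.mem_iUnion] at hω
    obtain ⟨c, -, h⟩ := hω
    exact h.1
  have hdisj : (J : Set (Finset (Fin (numNodes p)) × Finset (Fin (numNodes p)))).PairwiseDisjoint
      fun c => cell p c.1 c.2 := by
    rintro ⟨U, T⟩ - ⟨U', T'⟩ - hne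
    rw [Function.onFun, Set.disjoint_left]
    rintro ω ⟨-, h1, h2⟩ ⟨-, h3, h4⟩
    exact hne (Prod.ext (Finset.coe_injective (h1.symm.trans h3))
      (Finset.coe_injective (Set.singleton_injective (h2.symm.trans h4))))
  -- The bad event forgets `T` and membership in `𝒩`. It is therefore counted once per `T`, which is
  -- harmless because each copy is negligible against its own cell.
  have hbad : C \ F ⊆ ⋃ c ∈ J, {ω | unlooped (ofBits ω) = c.1 ∧
      ¬ Quasirandom (ofBits ω) c.1 (nOf p) (kOf p)} := by
    rintro ω ⟨hωC, hωF⟩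
    obtain ⟨T, hT, hU, -, h0, hUT, hLT⟩ := id hωC
    have hTm : T ∈ {S | IsTournament (ofBits ω) S ∧ S.ncard = kOf p} := by rw [hT]; rfl
    simp only [Set.mem_iUnion]
    refine ⟨((unlooped (ofBits ω)).toFinset, T.toFinset), ?_, ?_, ?_⟩
    · simp only [J, Finset.mem_filter, Finset.mem_univ, true_and]
      refine ⟨?_, ?_, ?_⟩
      · rw [← Set.ncard_eq_toFinset_card', hU]
      · rw [← Set.ncard_eq_toFinset_card', hTm.2]
      · rw [Set.disjoint_toFinset]
        exact Set.disjoint_left.2 fun x h1 h2 => isTournament_subset_compl_unlooped hTm.1 h2 h1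
    · simp
    · intro hq
      rw [Set.coe_toFinset] at hq
      exact hωF ⟨hωC, blanksForced_of_quasirandom hT hU h0 hUT hLT (by omega) (by omega) hq⟩
  have hle : pr (C \ F) ≤ Real.exp (-(kOf p : ℝ)) * pr C := by
    calc pr (C \ F) ≤ _ := pr_mono hbad
      _ ≤ _ := pr_iUnion_le J _
      _ ≤ ∑ c ∈ J, Real.exp (-(kOf p : ℝ)) * pr (cell p c.1 c.2) :=
          Finset.sum_le_sum fun c hc =>
            (pr_not_quasirandom_le_cell hp (hJ c hc).1 (hJ c hc).2.1 (hJ c hc).2.2).2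
      _ = Real.exp (-(kOf p : ℝ)) * ∑ c ∈ J, pr (cell p c.1 c.2) := by rw [Finset.mul_sum]
      _ ≤ Real.exp (-(kOf p : ℝ)) * pr C := by
          gcongr
          exact (sum_pr_le_of_disjoint J _ hdisj).trans (pr_mono hcells)
  -- The class must be non-empty for the ratio to be meaningful; any single cell shows this.
  have hpos : 0 < pr C := by
    obtain ⟨U, -, hU⟩ := Finset.exists_subset_card_eq
      (show nOf p ≤ (Finset.univ : Finset (Fin (numNodes p))).card by
        rw [Finset.card_univ, Fintype.card_fin, numNodes]; omega)
    obtain ⟨T, hTU, hT⟩ := Finset.exists_subset_card_eq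
      (show kOf p ≤ Uᶜ.card by
        rw [Finset.card_compl, Fintype.card_fin, hU, numNodes]; omega)
    have hUT : Disjoint U T := Finset.disjoint_right.2 fun x hx => by simpa using hTU hx
    exact lt_of_lt_of_le (pr_not_quasirandom_le_cell hp hU hT hUT).1 (pr_mono fun ω h => h.1)
  have hsplit := pr_le_add_pr_diff C F
  rw [ncard_eq_pr_mul, ncard_eq_pr_mul, mul_div_mul_right _ _ (by positivity), le_div_iff₀ hpos]
  change _ ≤ pr F
  change (1 - _) * pr C ≤ _
  linarith

end GraphColoration

theorem proposition4 :
    Tendsto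
      (fun p : ℕ =>
        ({G ∈ GraphColoration.classN p | GraphColoration.BlanksForced G p}.ncard : ℝ) /
          ((GraphColoration.classN p).ncard : ℝ))
      atTop (𝓝 1) := by
  open GraphColoration in
  have hlow : Tendsto (fun p : ℕ => 1 - Real.exp (-(kOf p : ℝ))) atTop (𝓝 1) := by
    have h := Real.tendsto_exp_neg_atTop_nhds_zero.comp
      (tendsto_natCast_atTop_atTop.comp tendsto_kOf)
    simpa using h.const_sub 1
  refine tendsto_of_tendsto_of_tendsto_of_le_of_le' hlow tendsto_const_nhds ?_ ?_
  · filter_upwards [GraphColoration.tendsto_kOf.eventually GraphColoration.eventually_largeK]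
      with p hp
    exact GraphColoration.one_sub_exp_le_ratio hp
  · refine Eventually.of_forall fun p => div_le_one_of_le₀ ?_ (by positivity)
    exact_mod_cast Set.ncard_le_ncard (Set.sep_subset _ _)
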